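/- **Definitions.** All graphs are finite; loops and parallel edges are allowed unless excluded (a loop is a cycle of length $1$, a pair of parallel edges a cycle of length $2$). A graph has girth at least $5$ if all its cycles have length at least $5$; it is cyclically $4$-edge-connected if every edge-cut separating two cycles (that is, every set of all edges between a vertex set $X$ and its complement, where both sides contain a cycle) has at least $4$ edges. For a cubic graph $G$ and a path $uv$ (resp. $uwv$) in it, let $G_{uv}$ (resp. $G_{uwv}$) be obtained by removing the vertices of the path and keeping the dangling edges; the two free ends (semiedges) formerly at $u$ form the *input*, the two formerly at $v$ the *output*, and in $G_{uwv}$ the one formerly at $w$ is *residual*. If $G$ is bipartite, $G_{uwv}$ is a *bipartite $(2,2;1)$-pole*. Let $p_1,\dots,p_4$ be a basis of $\mathbb F_2^4$. The *tetrahedron* spanned by it has the six lines $\{p_i,\,p_i+p_j,\,p_j\}$, $i\ne j$, and the ten points lying on them. A *tetrahedral flow* assigns a point of the tetrahedron to each edge (dangling or not) so that the values at the three edges at each vertex form a line. A *decollineator* is a dipole with two input semiedges, two output semiedges and no residual ones such that, for no tetrahedral flow, both the pair of input values and the pair of output values consist of two distinct points of one line of the tetrahedron. (For $G_{uv}$ this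 is equivalent to saying that the edges of $G$ cannot be covered with four perfect matchings.) A *cubic Halin graph* $H=C\cup S$ consists of a tree $S$ and a circuit $C$ of length $k\ge 3$ whose vertices $v_0,\dots,v_{k-1}$, in cyclic order, are exactly the leaves of $S$, such that $H$ is cubic and $C\cup S$ is embedded in the plane. A *Halin snark* $H^\sharp$ arises from $H$ as follows. For each $i\in\mathbb Z_k$ take a *Halin fragment* $F_i=D_i\circ B_i$, where $D_i$ is a decollineator, $B_i$ is a bipartite $(2,2;1)$-pole, and $\circ$ welds the output of $D_i$ with the input of $B_i$. Weld the output of $F_i$ with the input of $F_{i+1}$ for each $i$ modulo $k$, add the tree $S-\{v_0,\dots,v_{k-1}\}$, and attach the residual semiedge of $F_i$ to the neighbour of $v_i$ in $S$. The pairings of the semiedges that are welded may be chosen arbitrarily. **Proposition.** Let $H^\sharp$ be a Halin snark such that, for each $i$, the decollineator is $D_i=(G_i)_{u_iv_i}$ for a cubic graph $G_i$ and adjacent vertices $u_i,v_i$ of $G_i$, the bipartite $(2,2;1)$-pole is $B_i=(G'_i)_{u'_iw'_iv'_i}$ for a bipartite cubic graph $G'_i$ and a path $u'_iw'_iv'_i$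 in it, and all the graphs $G_i$ and $G'_i$ are cyclically $4$-edge-connected and of girth at least $5$. Then $H^\sharp$ is cyclically $4$-edge-connected and has girth at least $5$. -/

import Mathlib

universe u

/-! ### Multigraphs -/

/-- An undirected multigraph with vertex set `V` and edge set `E`; loops and parallel edges are
allowed. -/
structure Multigraph (V E : Type*) where
  ends : E → Sym2 V

namespace Multigraph

variable {V E : Type*}

/-- Every vertex is incident with exactly three edge-ends (a loop contributes two of them). -/
def IsCubic (G : Multigraph V E) : Prop :=
  ∀ v : V, {e : E | v ∈ G.ends e}.encard + {e : E | G.ends e = s(v, v)}.encard = 3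

/-- Adjacent distinct vertices. -/
def Adj (G : Multigraph V E) (u v : V) : Prop :=
  u ≠ v ∧ ∃ e : E, G.ends e = s(u, v)

/-- There is a proper colouring of the vertices with two colours. -/
def IsBipartite (G : Multigraph V E) : Prop :=
  ∃ c : V → Bool, ∀ (e : E) (x y : V), G.ends e = s(x, y) → c x ≠ c y

/-- `G` has a cycle of length `n` all of whose vertices lie in `X`. A loop is a cycle of length 1,
two parallel edges form a cycle of length 2. -/
def HasCycleIn (G : Multigraph V E) (X : Set V) (n : ℕ) : Prop :=
  0 < n ∧ ∃ (x : ZMod n → V) (e : ZMod n → E), Function.Injective x ∧ Function.Injective e ∧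
    (∀ i, x i ∈ X) ∧ ∀ i, G.ends (e i) = s(x i, x (i + 1))

/-- The girth of `G` is at least `g`: every cycle has length at least `g`. -/
def GirthAtLeast (G : Multigraph V E) (g : ℕ) : Prop :=
  ∀ n : ℕ, G.HasCycleIn Set.univ n → g ≤ n

/-- The edge-cut of all edges between `X` and its complement. -/
def edgeCut (G : Multigraph V E) (X : Set V) : Set E :=
  {e | ∃ x ∈ X, ∃ y ∉ X, G.ends e = s(x, y)}

/-- Every edge-cut that separates two cycles from each other has at least `m` edges. The empty
edge-cut is not exempted, so that for `0 < m` cycles in two different components are ruled out. -/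
def CyclicallyEdgeConnected (G : Multigraph V E) (m : ℕ) : Prop :=
  ∀ X : Set V, (∃ n, G.HasCycleIn X n) → (∃ n, G.HasCycleIn Xᶜ n) → (m : ℕ∞) ≤ (G.edgeCut X).encard

end Multigraph

/-! ### Dipoles -/

/-- A dipole with vertex set `V`, set `E` of edges with both ends at vertices, and dangling edges,
each of which is incident with one vertex and has one free end (semiedge). The semiedges form the
input connector `I`, the output connector `O` and the set `R` of residual semiedges; each of them is
mapped to the vertex at the other end of its dangling edge. -/
structure Dipole (V E I O R : Type*) where
  ends : E → Sym2 V
  inp : I → V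
  out : O → V
  res : R → V

/-- The dipole is an `(a, b; c)`-pole. -/
def Dipole.IsPole {V E I O R : Type*} (_D : Dipole V E I O R) (a b c : ℕ) : Prop :=
  ENat.card I = a ∧ ENat.card O = b ∧ ENat.card R = c

namespace Multigraph

variable {V E : Type*}

/-- The edges that survive the removal of the vertices in `P`. -/
abbrev Kept (G : Multigraph V E) (P : Set V) : Type _ :=
  {e : E // ∀ x ∈ G.ends e, x ∉ P}

/-- The semiedges formerly incident with `u ∈ P` that arise by removing the vertices in `P`: an edge
from `u` to a vertex outside of `P` (recorded as the second component) loses its end `u`. -/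
abbrev Freed (G : Multigraph V E) (P : Set V) (u : V) : Type _ :=
  {p : E × V // G.ends p.1 = s(u, p.2) ∧ p.2 ∉ P}

/-- The ends of a surviving edge. -/
def keptEnds (G : Multigraph V E) (P : Set V) (e : G.Kept P) : Sym2 {x : V // x ∉ P} :=
  (G.ends e.1).attachWith e.2

/-- The dipole `G_{uv}` obtained by removing a path `uv` of length 1: the semiedges formerly incident
with `u` form the input, those formerly incident with `v` form the output. -/
def removeUV (G : Multigraph V E) (u v : V) :
    Dipole {x : V // x ∉ ({u, v} : Set V)} (G.Kept {u, v}) (G.Freed {u, v} u) (G.Freed {u, v} v)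
      Empty where
  ends := G.keptEnds {u, v}
  inp p := ⟨p.1.2, p.2.2⟩
  out p := ⟨p.1.2, p.2.2⟩
  res := Empty.elim

/-- The dipole `G_{uwv}` obtained by removing a path `uwv` of length 2: the semiedges formerly
incident with `u` form the input, those formerly incident with `v` form the output, the one formerly
incident with `w` is residual. -/
def removeUWV (G : Multigraph V E) (u w v : V) :
    Dipole {x : V // x ∉ ({u, w, v} : Set V)} (G.Kept {u, w, v}) (G.Freed {u, w, v} u)
      (G.Freed {u, w, v} v) (G.Freed {u, w, v} w) where
  ends := G.keptEnds {u, w, v}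
  inp p := ⟨p.1.2, p.2.2⟩
  out p := ⟨p.1.2, p.2.2⟩
  res p := ⟨p.1.2, p.2.2⟩

end Multigraph

/-- The join `D ∘ B`: each semiedge `s` in the output of `D` is welded with the semiedge `f s` in the
input of `B`. -/
def Dipole.join {V₁ E₁ I₁ O₁ R₁ V₂ E₂ I₂ O₂ R₂ : Type*} (D : Dipole V₁ E₁ I₁ O₁ R₁)
    (B : Dipole V₂ E₂ I₂ O₂ R₂) (f : O₁ ≃ I₂) :
    Dipole (V₁ ⊕ V₂) (E₁ ⊕ E₂ ⊕ O₁) I₁ O₂ (R₁ ⊕ R₂) where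
  ends := Sum.elim (fun e => (D.ends e).map Sum.inl)
    (Sum.elim (fun e => (B.ends e).map Sum.inr) fun s => s(Sum.inl (D.out s), Sum.inr (B.inp (f s))))
  inp s := Sum.inl (D.inp s)
  out s := Sum.inr (B.out s)
  res := Sum.elim (fun s => Sum.inl (D.res s)) fun s => Sum.inr (B.res s)

/-! ### Tetrahedral flows and decollineators -/

/-- The six lines of the tetrahedron in `PG(3,2)` with corner points `p 0`, `p 1`, `p 2`, `p 3`;
points of `PG(3,2)` are the nonzero vectors of `𝔽₂⁴`, and the corner points are in general position
when they are linearly independent. -/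
def tetraLines (p : Fin 4 → Fin 4 → ZMod 2) : Set (Set (Fin 4 → ZMod 2)) :=
  {l | ∃ i j : Fin 4, i ≠ j ∧ l = {p i, p i + p j, p j}}

/-- The ten points of the tetrahedron. -/
def tetraPoints (p : Fin 4 → Fin 4 → ZMod 2) : Set (Fin 4 → ZMod 2) :=
  ⋃₀ tetraLines p

namespace Dipole

variable {V E I O R : Type*}

/-- A tetrahedral flow with respect to `p`: all edges, dangling or not, carry points of the
tetrahedron, and the values at each vertex form a line of it. -/
def IsTetraFlow (D : Dipole V E I O R) (p : Fin 4 → Fin 4 → ZMod 2) (φE : E → Fin 4 → ZMod 2)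
    (φI : I → Fin 4 → ZMod 2) (φO : O → Fin 4 → ZMod 2) (φR : R → Fin 4 → ZMod 2) : Prop :=
  (∀ e, φE e ∈ tetraPoints p) ∧ (∀ s, φI s ∈ tetraPoints p) ∧
  (∀ s, φO s ∈ tetraPoints p) ∧ (∀ s, φR s ∈ tetraPoints p) ∧
  ∀ x : V, φE '' {e | x ∈ D.ends e} ∪ φI '' {s | D.inp s = x} ∪ φO '' {s | D.out s = x} ∪
    φR '' {s | D.res s = x} ∈ tetraLines p

/-- A decollineator is a `(2,2)`-pole without collinear transitions: there is no tetrahedral flow for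
which both the input pair and the output pair consist of two distinct points of one line. -/
def IsDecollineator (D : Dipole V E I O R) : Prop :=
  D.IsPole 2 2 0 ∧
  ∀ p : Fin 4 → Fin 4 → ZMod 2, LinearIndependent (ZMod 2) p →
    ∀ φE φI φO φR, D.IsTetraFlow p φE φI φO φR →
      ¬ ((Function.Injective φI ∧ ∃ l ∈ tetraLines p, Set.range φI ⊆ l) ∧
        (Function.Injective φO ∧ ∃ l ∈ tetraLines p, Set.range φO ⊆ l))

end Dipole

/-! ### Cubic Halin graphs -/

/-- A combinatorial embedding of a graph: a rotation of the darts, which cyclically permutes the darts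
leaving each vertex. -/
structure RotationSystem {W : Type*} (H : SimpleGraph W) where
  rot : Equiv.Perm H.Dart
  fst_rot : ∀ d, (rot d).fst = d.fst
  sameCycle : ∀ d d' : H.Dart, d.fst = d'.fst → rot.SameCycle d d'

namespace RotationSystem

variable {W : Type*} {H : SimpleGraph W}

/-- The permutation of the darts whose cycles are the boundaries of the faces. -/
def facePerm (ρ : RotationSystem H) : Equiv.Perm H.Dart :=
  (SimpleGraph.Dart.symm_involutive (G := H)).toPerm.trans ρ.rot

/-- The faces of the embedding. -/
def Face (ρ : RotationSystem H) : Type _ :=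
  Quotient (Equiv.Perm.SameCycle.setoid ρ.facePerm)

/-- The embedding of the (finite, connected) graph is plane, by Euler's formula. -/
def IsPlane (ρ : RotationSystem H) : Prop :=
  Nat.card W + Nat.card ρ.Face = Nat.card H.edgeSet + 2

end RotationSystem

/-- The circuit `v 0, v 1, …, v (k - 1)`. -/
def circuitGraph {W : Type*} {k : ℕ} (v : ZMod k → W) : SimpleGraph W :=
  SimpleGraph.fromEdgeSet (Set.range fun i => s(v i, v (i + 1)))

/-- The tree `S` and the circuit `v 0, v 1, …, v (k - 1)` through the leaves of `S` form a cubic Halin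
graph. -/
structure IsCubicHalin {W : Type*} (S : SimpleGraph W) {k : ℕ} (v : ZMod k → W) : Prop where
  isTree : S.IsTree
  no_two : ∀ w, (S.neighborSet w).encard ≠ 2
  three_le : 3 ≤ k
  injective : Function.Injective v
  leaves : ∀ w, w ∈ Set.range v ↔ (S.neighborSet w).encard = 1
  cubic : ∀ w, ((S ⊔ circuitGraph v).neighborSet w).encard = 3
  plane : ∃ ρ : RotationSystem (S ⊔ circuitGraph v), ρ.IsPlane

/-! ### Halin snarks -/

/-- The graph formed from dipoles `F i`, indexed cyclically, and the tree `S` with leaves `v i` by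
welding the output of `F i` with the input of `F (i + 1)` according to `g i`, by adding the tree
obtained from `S` by removing the leaves, and by attaching the residual semiedges of `F i` to the
vertex `t i` of this tree. The four kinds of edges are listed in this order: edges of the `F i`,
welded edges, tree edges, edges between the `F i` and the tree. -/
def closeUp {W : Type*} {k : ℕ} (S : SimpleGraph W) (v : ZMod k → W)
    (t : ZMod k → {w : W // w ∉ Set.range v}) {VF EF I O R : ZMod k → Type*}
    (F : ∀ i, Dipole (VF i) (EF i) (I i) (O i) (R i)) (g : ∀ i, O i ≃ I (i + 1)) :
    Multigraph ((Σ i, VF i) ⊕ {w : W // w ∉ Set.range v})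
      ((Σ i, EF i) ⊕ (Σ i, O i) ⊕ (S.induce {w | w ∉ Set.range v}).edgeSet ⊕ (Σ i, R i)) where
  ends := Sum.elim (fun e => ((F e.1).ends e.2).map fun x => Sum.inl ⟨e.1, x⟩)
    (Sum.elim
      (fun s => s(Sum.inl ⟨s.1, (F s.1).out s.2⟩, Sum.inl ⟨s.1 + 1, (F (s.1 + 1)).inp (g s.1 s.2)⟩))
      (Sum.elim (fun e => e.1.map Sum.inr)
        fun s => s(Sum.inl ⟨s.1, (F s.1).res s.2⟩, Sum.inr (t s.1))))

/-- A Halin snark, given by its construction: a cubic Halin graph with perimeter circuit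
`v 0, …, v (k - 1)`, and, for each `i`, a Halin fragment `F i = D i ∘ B i` that substitutes `v i`.
Here `D i` is a decollineator that arises from a cubic graph `G i` by removing two adjacent
vertices `a i`, `b i`, and `B i` is a bipartite `(2,2;1)`-pole, which arises from a bipartite cubic
graph `G' i` by removing a path `a' i`, `c' i`, `b' i`. All graphs are finite. All pairings of
semiedges between consecutive connectors are allowed. -/
structure HalinSnark where
  k : ℕ
  W : Type u
  finite_W : Finite W
  S : SimpleGraph W
  v : ZMod k → W
  isHalin : IsCubicHalin S v
  /-- the inner neighbour of the leaf `v i` in the tree -/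
  t : ZMod k → {w : W // w ∉ Set.range v}
  adj_t : ∀ i, S.Adj (v i) (t i)
  V : ZMod k → Type u
  E : ZMod k → Type u
  finite_V : ∀ i, Finite (V i)
  finite_E : ∀ i, Finite (E i)
  G : ∀ i, Multigraph (V i) (E i)
  cubic_G : ∀ i, (G i).IsCubic
  a : ∀ i, V i
  b : ∀ i, V i
  adj_ab : ∀ i, (G i).Adj (a i) (b i)
  isDecollineator : ∀ i, ((G i).removeUV (a i) (b i)).IsDecollineator
  V' : ZMod k → Type u
  E' : ZMod k → Type u
  finite_V' : ∀ i, Finite (V' i)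
  finite_E' : ∀ i, Finite (E' i)
  G' : ∀ i, Multigraph (V' i) (E' i)
  cubic_G' : ∀ i, (G' i).IsCubic
  bipartite_G' : ∀ i, (G' i).IsBipartite
  a' : ∀ i, V' i
  c' : ∀ i, V' i
  b' : ∀ i, V' i
  adj_ac' : ∀ i, (G' i).Adj (a' i) (c' i)
  adj_cb' : ∀ i, (G' i).Adj (c' i) (b' i)
  ne_ab' : ∀ i, a' i ≠ b' i
  isPole_B : ∀ i, ((G' i).removeUWV (a' i) (c' i) (b' i)).IsPole 2 2 1
  /-- the pairing of the output of `D i` with the input of `B i` -/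
  f : ∀ i, (G i).Freed {a i, b i} (b i) ≃ (G' i).Freed {a' i, c' i, b' i} (a' i)
  /-- the pairing of the output of `B i` with the input of `D (i + 1)` -/
  g : ∀ i, (G' i).Freed {a' i, c' i, b' i} (b' i) ≃
    (G (i + 1)).Freed {a (i + 1), b (i + 1)} (a (i + 1))

namespace HalinSnark

/-- The decollineator `D i`. -/
abbrev D (X : HalinSnark.{u}) (i : ZMod X.k) := (X.G i).removeUV (X.a i) (X.b i)

/-- The bipartite `(2,2;1)`-pole `B i`. -/
abbrev B (X : HalinSnark.{u}) (i : ZMod X.k) := (X.G' i).removeUWV (X.a' i) (X.c' i) (X.b' i)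

/-- The Halin fragment `F i = D i ∘ B i`. -/
abbrev F (X : HalinSnark.{u}) (i : ZMod X.k) := (X.D i).join (X.B i) (X.f i)

/-- The Halin snark as a graph. -/
abbrev graph (X : HalinSnark.{u}) := closeUp X.S X.v X.t X.F X.g

end HalinSnark

/-! Call each $D_i$, each $B_i$ and the inner tree a part. The $2k$ poles $D_0,B_0,D_1,B_1,\dots$
form a circle in which consecutive ones are joined by two welded edges, and each $B_i$ sends one
residual edge to the tree.

Girth. Removing an edge or a path of length 2 from a graph of girth at least 5 leaves each vertex
with at most one neighbour on it, so a vertex of a pole has at most one edge leaving its pole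
(`edge_unique_of_lab_ne`). A triangle that changes parts is then impossible, and a quadrangle has to
meet two parts in one edge each. If one part is the tree, the single residual edge excludes this
(`not_link_of_lab_b`); otherwise one part is some $D_i$, and that edge, together with removed
vertices, gives a cycle of length at most 4 in $G_i$ (`not_link_of_lab_d`).

Connectivity. Suppose a cut has fewer than 4 edges. If it splits a pole, at least two of its edges
lie inside that pole (`two_le_encard_inner`); if two consecutive unsplit poles are on different
sides, both welded edges are cut. These zones are disjoint, so at most one of them contains two cut
edges (`eq_of_busy`). Going around the circle, all poles but one lie on the same side
(`exists_forall_allIn`). The other side is then $Q\cup Z$ with $Q$ in a single pole and $Z$ in the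
tree, and counting the edges that leave it shows that if it contains a cycle, the cut has at least 4
edges (`four_le_encard_edgeCut_of_forall_allIn`). The counts rest on one bound: $n\ge 1$ vertices
inducing a forest, each with at least 3 incident edges, send out at least $n+2$ edges
(`encard_add_two_le_encard_edgeCut`). -/

namespace Multigraph

/-! ### Girth at least 5 in local form. -/

variable {V E : Type*} {G : Multigraph V E}

/-- The vertices `x` and `y` are joined by an edge. -/
def Link (G : Multigraph V E) (x y : V) : Prop := ∃ e, G.ends e = s(x, y)

theorem Link.symm {x y : V} (h : G.Link x y) : G.Link y x := by
  obtain ⟨e, he⟩ := h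
  exact ⟨e, he.trans Sym2.eq_swap⟩

theorem HasCycleIn.mono {X Y : Set V} {n : ℕ} (h : G.HasCycleIn X n) (hXY : X ⊆ Y) :
    G.HasCycleIn Y n := by
  obtain ⟨hn, x, e, hx, he, hX, h⟩ := h
  exact ⟨hn, x, e, hx, he, fun i => hXY (hX i), h⟩

theorem edgeCut_compl (X : Set V) : G.edgeCut Xᶜ = G.edgeCut X := by
  ext e
  constructor
  · rintro ⟨x, hx, y, hy, h⟩
    exact ⟨y, by simpa using hy, x, hx, h.trans Sym2.eq_swap⟩
  · rintro ⟨x, hx, y, hy, h⟩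
    exact ⟨y, hy, x, by simpa using hx, h.trans Sym2.eq_swap⟩

/-- No loops, no parallel edges, no triangles, no quadrangles. -/
structure ShortCycleFree (G : Multigraph V E) : Prop where
  loop : ∀ x, ¬ G.Link x x
  parallel : ∀ e e', G.ends e = G.ends e' → e = e'
  triangle : ∀ x y z, G.Link x y → G.Link y z → G.Link z x → False
  quad : ∀ x y z w, x ≠ z → y ≠ w → G.Link x y → G.Link y z → G.Link z w → G.Link w x → False

/-- Excluded adjacency patterns can be pulled back from the Halin snark to its parts edge by edge,
so girth is translated into this form and back. -/
theorem ShortCycleFree.girthAtLeast (h : G.ShortCycleFree) : G.GirthAtLeast 5 := by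
  rintro n ⟨hn, x, e, hx, he, -, hc⟩
  by_contra hlt
  have hl : ∀ i, G.Link (x i) (x (i + 1)) := fun i => ⟨e i, hc i⟩
  obtain rfl | rfl | rfl | rfl : n = 1 ∨ n = 2 ∨ n = 3 ∨ n = 4 := by omega
  · exact h.loop _ (hl 0)
  · have h0 := hc 0
    have h1 := hc 1
    have : (0 : ZMod 2) = 1 := he (h.parallel _ _ (by
      rw [h0, h1, show (1 + 1 : ZMod 2) = 0 from rfl, zero_add]
      exact Sym2.eq_swap))
    exact absurd this (by decide)
  · exact h.triangle (x 0) (x 1) (x 2) (hl 0) (hl 1) (hl 2)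
  · exact h.quad (x 0) (x 1) (x 2) (x 3) (fun h => absurd (hx h) (by decide))
      (fun h => absurd (hx h) (by decide)) (hl 0) (hl 1) (hl 2) (hl 3)

theorem GirthAtLeast.shortCycleFree (h : G.GirthAtLeast 5) : G.ShortCycleFree := by
  have loop : ∀ x, ¬ G.Link x x := by
    rintro x ⟨e, he⟩
    have := h 1 ⟨one_pos, fun _ => x, fun _ => e, fun _ _ _ => Subsingleton.elim _ _,
      fun _ _ _ => Subsingleton.elim _ _, fun _ => trivial, fun _ => he⟩
    omega
  have ne : ∀ {x y}, G.Link x y → x ≠ y := by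
    rintro x y hl rfl
    exact loop x hl
  have parallel : ∀ e e', G.ends e = G.ends e' → e = e' := by
    intro e e' hee
    by_contra hne
    obtain ⟨x, y, hxy⟩ : ∃ x y, G.ends e = s(x, y) := by
      induction hs : G.ends e using Sym2.ind with | _ x y => exact ⟨x, y, rfl⟩
    have hn := ne ⟨e, hxy⟩
    -- `ZMod 2` unfolds to `Fin 2`, so a cycle can be given by vectors.
    have := h 2 ⟨two_pos, (![x, y] : Fin 2 → V), (![e, e'] : Fin 2 → E), ?_, ?_, fun _ => trivial, ?_⟩
    · omega
    · intro i j hij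
      fin_cases i <;> fin_cases j <;> first | rfl | (exfalso; simp at hij; tauto)
    · intro i j hij
      fin_cases i <;> fin_cases j <;> first | rfl | (exfalso; simp at hij; tauto)
    · intro i
      fin_cases i
      · exact hxy
      · exact hee.symm.trans (hxy.trans Sym2.eq_swap)
  refine ⟨loop, parallel, ?_, ?_⟩
  · intro x y z hxy hyz hzx
    have h1 := ne hxy
    have h2 := ne hyz
    have h3 := ne hzx
    obtain ⟨e, he⟩ := hxy
    obtain ⟨f, hf⟩ := hyz
    obtain ⟨g, hg⟩ := hzx
    have k1 : e ≠ f := by rintro rfl; rw [he] at hf; simp at hf; tauto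
    have k2 : f ≠ g := by rintro rfl; rw [hf] at hg; simp at hg; tauto
    have k3 : g ≠ e := by rintro rfl; rw [he] at hg; simp at hg; tauto
    have := h 3 ⟨three_pos, (![x, y, z] : Fin 3 → V), (![e, f, g] : Fin 3 → E), ?_, ?_,
      fun _ => trivial, ?_⟩
    · omega
    · intro i j hij
      fin_cases i <;> fin_cases j <;> first | rfl | (exfalso; simp at hij; tauto)
    · intro i j hij
      fin_cases i <;> fin_cases j <;> first | rfl | (exfalso; simp at hij; tauto)
    · intro i
      fin_cases i
      · exact he
      · exact hf
      · exact hg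
  · intro x y z w hxz hyw hxy hyz hzw hwx
    have h1 := ne hxy
    have h2 := ne hyz
    have h3 := ne hzw
    have h4 := ne hwx
    obtain ⟨e, he⟩ := hxy
    obtain ⟨f, hf⟩ := hyz
    obtain ⟨g, hg⟩ := hzw
    obtain ⟨d, hd⟩ := hwx
    have k1 : e ≠ f := by rintro rfl; rw [he] at hf; simp at hf; tauto
    have k2 : e ≠ g := by rintro rfl; rw [he] at hg; simp at hg; tauto
    have k3 : e ≠ d := by rintro rfl; rw [he] at hd; simp at hd; tauto
    have k4 : f ≠ g := by rintro rfl; rw [hf] at hg; simp at hg; tauto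
    have k5 : f ≠ d := by rintro rfl; rw [hf] at hd; simp at hd; tauto
    have k6 : g ≠ d := by rintro rfl; rw [hg] at hd; simp at hd; tauto
    have := h 4 ⟨four_pos, (![x, y, z, w] : Fin 4 → V), (![e, f, g, d] : Fin 4 → E), ?_, ?_,
      fun _ => trivial, ?_⟩
    · omega
    · intro i j hij
      fin_cases i <;> fin_cases j <;> first | rfl | (exfalso; simp at hij; tauto)
    · intro i j hij
      fin_cases i <;> fin_cases j <;> first | rfl | (exfalso; simp at hij; tauto)
    · intro i
      fin_cases i
      · exact he
      · exact hf
      · exact hg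
      · exact hd

/-! ### Forests and small edge-cuts. -/

/-- A set in which every vertex has at least two incident edges contains a cycle. -/
theorem exists_hasCycleIn {X : Set V} (hfin : X.Finite) (hne : X.Nonempty)
    (h : ∀ x ∈ X, {e | ∃ y ∈ X, G.ends e = s(x, y)}.Nontrivial) : ∃ n, G.HasCycleIn X n := by
  -- A walk without immediate return inside `X`; its state is the current vertex with the edge just
  -- used.
  have hnext : ∀ p : X × E, ∃ q : X × E, q.2 ≠ p.2 ∧ G.ends q.2 = s(p.1.1, q.1.1) := by
    rintro ⟨⟨x, hx⟩, e⟩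
    obtain ⟨e', ⟨y, hy, hxy⟩, hee⟩ := (h x hx).exists_ne e
    exact ⟨⟨⟨y, hy⟩, e'⟩, hee, hxy⟩
  choose nxt hnxt using hnext
  obtain ⟨x₀, hx₀⟩ := hne
  obtain ⟨e₀, -⟩ := (h x₀ hx₀).nonempty
  let p : ℕ → X × E := fun n => nxt^[n] (⟨x₀, hx₀⟩, e₀)
  have hp : ∀ n, p (n + 1) = nxt (p n) := fun n => Function.iterate_succ_apply' _ _ _
  let y : ℕ → V := fun n => (p n).1.1
  let e : ℕ → E := fun n => (p n).2
  have hye : ∀ n, G.ends (e (n + 1)) = s(y n, y (n + 1)) := by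
    intro n
    simp only [e, y, hp]
    exact (hnxt _).2
  have hee : ∀ n, e (n + 1) ≠ e n := by
    intro n
    simp only [e, hp]
    exact (hnxt _).1
  have hrep : ∃ d, 0 < d ∧ ∃ i, y i = y (i + d) := by
    have : Finite X := hfin
    obtain ⟨i, j, hij, hne⟩ : ∃ i j, (p i).1 = (p j).1 ∧ i ≠ j := by
      have := not_injective_infinite_finite (fun n => (p n).1)
      simpa [Function.Injective] using this
    rcases lt_or_gt_of_ne hne with hlt | hlt
    · exact ⟨j - i, by omega, i, by
        simp only [y]; rw [show i + (j - i) = j by omega, hij]⟩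
    · exact ⟨i - j, by omega, j, by
        simp only [y]; rw [show j + (i - j) = i by omega, hij]⟩
  classical
  -- The shortest distance between two visits of the same vertex: the closed stretch between them is
  -- a cycle.
  obtain ⟨hpos, i, hi⟩ := Nat.find_spec hrep
  have hmin : ∀ a b, a < b → b - a < Nat.find hrep → y (i + a) ≠ y (i + b) := fun a b hab hlt heq =>
    Nat.find_min hrep hlt ⟨by omega, i + a, by rw [heq]; congr 1; omega⟩
  generalize Nat.find hrep = d at hpos hi hmin
  obtain ⟨m, rfl⟩ : ∃ m, d = m + 1 := ⟨d - 1, by omega⟩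
  have hyinj : ∀ a b, a < m + 1 → b < m + 1 → y (i + a) = y (i + b) → a = b := by
    intro a b ha hb hab
    rcases lt_trichotomy a b with hlt | rfl | hlt
    · exact absurd hab (hmin a b hlt (by omega))
    · rfl
    · exact absurd hab.symm (hmin b a hlt (by omega))
  have heinj : ∀ a b, a < b → b < m + 1 → e (i + a + 1) ≠ e (i + b + 1) := by
    intro a b hab hb heq
    have h1 := hye (i + a)
    rw [heq, hye (i + b), Sym2.eq_iff] at h1
    rcases h1 with ⟨h1, -⟩ | ⟨h1, -⟩
    · exact hmin a b hab (by omega) h1.symm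
    -- An edge traversed again in the opposite direction either repeats a vertex too soon or is an
    -- immediate return.
    · rcases Nat.lt_or_ge (a + 1) b with hlt | hge
      · exact hmin (a + 1) b hlt (by omega) h1.symm
      · obtain rfl : b = a + 1 := by omega
        exact hee _ heq.symm
  refine ⟨m + 1, hpos, fun j : Fin (m + 1) => y (i + j.1), fun j : Fin (m + 1) => e (i + j.1 + 1),
    ?_, ?_, ?_, ?_⟩
  · intro a b hab
    exact Fin.ext (hyinj a.1 b.1 a.2 b.2 hab)
  · intro a b hab
    rcases lt_trichotomy a.1 b.1 with hlt | hlt | hlt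
    · exact absurd hab (heinj _ _ hlt b.2)
    · exact Fin.ext hlt
    · exact absurd hab.symm (heinj _ _ hlt a.2)
  · intro j
    exact (p _).1.2
  · intro (j : Fin (m + 1))
    change G.ends (e (i + j.1 + 1)) = s(y (i + j.1), y (i + (j + 1 : Fin (m + 1)).1))
    suffices h : y (i + j.1 + 1) = y (i + (j + 1 : Fin (m + 1)).1) by rw [hye, h]
    rw [Fin.val_add_one]
    split_ifs with hj
    · subst hj
      exact hi.symm
    · rw [add_assoc]

theorem HasCycleIn.of_loop {X : Set V} {x : V} (hx : x ∈ X) (h : G.Link x x) :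
    G.HasCycleIn X 1 := by
  obtain ⟨e, he⟩ := h
  exact ⟨one_pos, fun _ => x, fun _ => e, fun _ _ _ => Subsingleton.elim _ _,
      fun _ _ _ => Subsingleton.elim _ _, fun _ => hx, fun _ => he⟩

/-- The number of edges leaving a nonempty set which induces a forest. -/
theorem encard_add_two_le_encard_edgeCut {X : Set V} (hfin : X.Finite) (hne : X.Nonempty)
    (hdeg : ∀ x ∈ X, 3 ≤ {e | x ∈ G.ends e}.encard) (hac : ∀ n, ¬ G.HasCycleIn X n) :
    X.encard + 2 ≤ (G.edgeCut X).encard := by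
  induction hn : X.ncard generalizing X with
  | zero =>
    rw [Set.ncard_eq_zero hfin] at hn
    exact absurd hn hne.ne_empty
  | succ m ih =>
    -- A leaf or isolated vertex of the forest. Putting it back adds its at least two outer edges to
    -- the cut and closes at most one.
    obtain ⟨x, hx, hsub⟩ : ∃ x ∈ X, {e | ∃ y ∈ X, G.ends e = s(x, y)}.Subsingleton := by
      by_contra! hcon
      obtain ⟨n, hn⟩ := exists_hasCycleIn hfin hne fun x hx =>
        hcon x hx
      exact hac n hn
    set Ein := {e | ∃ y ∈ X, G.ends e = s(x, y)} with hEin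
    set Eout := {e | ∃ y, y ∉ X ∧ G.ends e = s(x, y)} with hEout
    have hin : Ein.encard ≤ 1 := Set.encard_le_one_iff_subsingleton.2 hsub
    have hout : 2 ≤ Eout.encard := by
      have h3 : (3 : ℕ∞) ≤ Ein.encard + Eout.encard := by
        refine (hdeg x hx).trans (le_trans (Set.encard_le_encard ?_) (Set.encard_union_le _ _))
        intro e he
        obtain ⟨y, hy⟩ := Sym2.mem_iff_exists.1 he
        by_cases hyX : y ∈ X
        · exact Or.inl ⟨y, hyX, hy⟩
        · exact Or.inr ⟨y, hyX, hy⟩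
      have h4 : (1 : ℕ∞) + 2 ≤ 1 + Eout.encard := by
        calc (1 : ℕ∞) + 2 = 3 := by norm_num
          _ ≤ _ := h3
          _ ≤ _ := by gcongr
      exact (ENat.add_le_add_iff_left (by simp)).1 h4
    have houtcut : Eout ⊆ G.edgeCut X := by
      rintro e ⟨y, hy, h⟩
      exact ⟨x, hx, y, hy, h⟩
    -- The bound fails for the empty set, so the induction starts at one vertex, all of whose edges
    -- leave.
    rcases (X \ {x}).eq_empty_or_nonempty with hempty | hne'
    · have hXx : X = {x} := Set.Subset.antisymm (by simpa [Set.sdiff_eq_empty] using hempty)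
        (by simpa using hx)
      have hin0 : Ein = ∅ := by
        rw [Set.eq_empty_iff_forall_notMem]
        rintro e ⟨y, hy, h⟩
        rw [hXx] at hy
        obtain rfl : y = x := hy
        exact hac 1 (.of_loop hx ⟨e, h⟩)
      have : (3 : ℕ∞) ≤ Eout.encard := by
        refine (hdeg x hx).trans (Set.encard_le_encard ?_)
        intro e he
        obtain ⟨y, hy⟩ := Sym2.mem_iff_exists.1 he
        by_cases hyX : y ∈ X
        · exact absurd (show e ∈ Ein from ⟨y, hyX, hy⟩) (by simp [hin0])
        · exact ⟨y, hyX, hy⟩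
      calc X.encard + 2 = 3 := by rw [hXx, Set.encard_singleton]; norm_num
        _ ≤ _ := this
        _ ≤ _ := Set.encard_le_encard houtcut
    · have hIH := ih (X := X \ {x}) (hfin.subset Set.sdiff_subset) hne'
        (fun y hy => hdeg y hy.1) (fun n hn => hac n (hn.mono Set.sdiff_subset))
        (by rw [Set.ncard_sdiff_singleton_of_mem hx, hn]; rfl)
      have hsub2 : G.edgeCut (X \ {x}) ⊆ (G.edgeCut X \ Eout) ∪ Ein := by
        rintro e ⟨y, ⟨hy, hyx⟩, z, hz, h⟩
        by_cases hzx : z = x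
        · subst hzx
          exact Or.inr ⟨y, hy, h.trans Sym2.eq_swap⟩
        · have hzX : z ∉ X := fun hzX => hz ⟨hzX, hzx⟩
          refine Or.inl ⟨⟨y, hy, z, hzX, h⟩, ?_⟩
          rintro ⟨w, hw, h'⟩
          rw [h, Sym2.eq_iff] at h'
          rcases h' with ⟨h1, -⟩ | ⟨-, h1⟩
          · exact hyx h1
          · exact hzx h1
      calc X.encard + 2 = (X \ {x}).encard + 1 + 2 := by
            rw [Set.encard_sdiff_singleton_add_one hx]
        _ = (X \ {x}).encard + 2 + 1 := by ring
        _ ≤ (G.edgeCut (X \ {x})).encard + 1 := by gcongr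
        _ ≤ ((G.edgeCut X \ Eout).encard + Ein.encard) + 1 := by
            gcongr
            exact (Set.encard_le_encard hsub2).trans (Set.encard_union_le _ _)
        _ ≤ (G.edgeCut X \ Eout).encard + 1 + 1 := by gcongr
        _ = (G.edgeCut X \ Eout).encard + 2 := by rw [add_assoc]; norm_num
        _ ≤ (G.edgeCut X \ Eout).encard + Eout.encard := by gcongr
        _ = _ := Set.encard_sdiff_add_encard_of_subset houtcut

theorem IsCubic.three_le (hc : G.IsCubic) (hl : ∀ x, ¬ G.Link x x) (x : V) :
    3 ≤ {e | x ∈ G.ends e}.encard := by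
  have h := hc x
  have h0 : {e : E | G.ends e = s(x, x)} = ∅ := by
    rw [Set.eq_empty_iff_forall_notMem]
    exact fun e he => hl x ⟨e, he⟩
  rw [h0, Set.encard_empty, add_zero] at h
  exact h.ge

theorem GirthAtLeast.not_hasCycleIn_of_subsingleton {X : Set V} (hg : G.GirthAtLeast 5)
    (hX : X.Subsingleton) (n : ℕ) : ¬ G.HasCycleIn X n := by
  intro h
  have h5 := hg n (h.mono (Set.subset_univ _))
  obtain ⟨-, x, -, hx, -, hxX, -⟩ := h
  have : Fact (1 < n) := ⟨by omega⟩
  exact zero_ne_one (hx (hX (hxX 0) (hxX 1)))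

theorem three_le_encard_edgeCut_singleton (hc : G.IsCubic) (hg : G.GirthAtLeast 5) (x : V) :
    3 ≤ (G.edgeCut {x}).encard := by
  have := encard_add_two_le_encard_edgeCut (Set.finite_singleton x) (Set.singleton_nonempty x)
    (fun y _ => hc.three_le hg.shortCycleFree.loop y)
    (hg.not_hasCycleIn_of_subsingleton Set.subsingleton_singleton)
  rw [Set.encard_singleton] at this
  exact le_trans (by norm_num) this

/-- In a cyclically 4-edge-connected cubic graph, cuts with at least two vertices on either side have
at least four edges. -/
theorem four_le_encard_edgeCut [Finite V] (hc : G.IsCubic) (hg : G.GirthAtLeast 5)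
    (h4 : G.CyclicallyEdgeConnected 4) {X : Set V} (hX : X.Nontrivial) (hX' : Xᶜ.Nontrivial) :
    4 ≤ (G.edgeCut X).encard := by
  -- A side without a cycle is a forest on at least two vertices and sends out at least $2+2$ edges.
  have key : ∀ Y : Set V, Y.Nontrivial → (∀ n, ¬ G.HasCycleIn Y n) → 4 ≤ (G.edgeCut Y).encard := by
    intro Y hY hac
    refine le_trans ?_ (encard_add_two_le_encard_edgeCut Y.toFinite hY.nonempty
      (fun y _ => hc.three_le hg.shortCycleFree.loop y) hac)
    have h2 : (2 : ℕ∞) ≤ Y.encard := by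
      have := Set.one_lt_encard_iff_nontrivial.2 hY
      simpa [one_add_one_eq_two] using Order.add_one_le_of_lt this
    calc (4 : ℕ∞) = 2 + 2 := by norm_num
      _ ≤ _ := by gcongr
  by_cases h1 : ∃ n, G.HasCycleIn X n
  · by_cases h2 : ∃ n, G.HasCycleIn Xᶜ n
    · exact h4 X h1 h2
    · rw [← edgeCut_compl]
      exact key _ hX' (by simpa using h2)
  · exact key _ hX (by simpa using h1)

end Multigraph

/-! ### Open graphs inside a larger graph. -/

namespace Multigraph

/-- An embedding into `M` of the open graph that is left of `G` when the vertices in `P` are removed.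
The edges of `G` with an end outside of `P` are enumerated by `τ`, and `ε` are their images. -/
structure OpenEmbedding {V E V' E' : Type*} (G : Multigraph V E) (P : Set V) (M : Multigraph V' E')
    (S : Type*) where
  ν : {x // x ∉ P} → V'
  τ : S → E
  ε : S → E'
  ν_inj : Function.Injective ν
  τ_inj : Function.Injective τ
  ε_inj : Function.Injective ε
  τ_surj : ∀ e x, x ∉ P → x ∈ G.ends e → ∃ s, τ s = e
  inner : ∀ s x y (hx : x ∉ P) (hy : y ∉ P), G.ends (τ s) = s(x, y) →
    M.ends (ε s) = s(ν ⟨x, hx⟩, ν ⟨y, hy⟩)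
  boundary : ∀ s x (hx : x ∉ P) p, p ∈ P → G.ends (τ s) = s(x, p) →
    ∃ z ∉ Set.range ν, M.ends (ε s) = s(ν ⟨x, hx⟩, z)
  surj : ∀ (x : {x // x ∉ P}) e', ν x ∈ M.ends e' → ∃ s, ε s = e' ∧ x.1 ∈ G.ends (τ s)

namespace OpenEmbedding

variable {V E V' E' S : Type*} {G : Multigraph V E} {P : Set V} {M : Multigraph V' E'}
  (ι : OpenEmbedding G P M S)

include ι in
-- Both `τ` and `ε` are injective, so edges may be counted in `S`.
theorem encard_le_of_forall {A : Set E} {B : Set E'} (h : ∀ e ∈ A, ∃ s, ι.τ s = e ∧ ι.ε s ∈ B) :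
    A.encard ≤ B.encard := by
  calc A.encard ≤ (ι.τ '' (ι.ε ⁻¹' B)).encard := Set.encard_le_encard fun e he => by
        obtain ⟨s, hs, hB⟩ := h e he
        exact ⟨s, hB, hs⟩
    _ = (ι.ε ⁻¹' B).encard := ι.τ_inj.encard_image _
    _ = (ι.ε '' (ι.ε ⁻¹' B)).encard := (ι.ε_inj.encard_image _).symm
    _ ≤ _ := Set.encard_le_encard (Set.image_preimage_subset _ _)

/-- Semiedges end outside of the range of `ν`, so edges from `Y` to `P` also stay in the cut. Lower
bounds for cuts of `G` thereby pass to `M`. -/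
theorem encard_edgeCut_le (Y : Set {x // x ∉ P}) :
    (G.edgeCut (Subtype.val '' Y)).encard ≤ (M.edgeCut (ι.ν '' Y)).encard := by
  refine ι.encard_le_of_forall ?_
  rintro e ⟨_, ⟨⟨x, hx⟩, hxY, rfl⟩, y, hy, h⟩
  obtain ⟨s, rfl⟩ := ι.τ_surj e x hx (by rw [h]; exact Sym2.mem_mk_left _ _)
  refine ⟨s, rfl, ι.ν ⟨x, hx⟩, ⟨_, hxY, rfl⟩, ?_⟩
  by_cases hyP : y ∈ P
  · obtain ⟨z, hz, hs⟩ := ι.boundary s x hx y hyP h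
    exact ⟨z, fun ⟨w, _, hw⟩ => hz ⟨w, hw⟩, hs⟩
  · refine ⟨ι.ν ⟨y, hyP⟩, ?_, ι.inner s x y hx hyP h⟩
    rintro ⟨w, hw, hwy⟩
    rw [ι.ν_inj hwy] at hw
    exact hy ⟨_, hw, rfl⟩

theorem exists_inner {x y : {x // x ∉ P}} {e' : E'} (he' : M.ends e' = s(ι.ν x, ι.ν y)) :
    ∃ s, ι.ε s = e' ∧ G.ends (ι.τ s) = s(x.1, y.1) := by
  obtain ⟨s, rfl, hx⟩ := ι.surj x e' (by rw [he']; exact Sym2.mem_mk_left _ _)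
  obtain ⟨w, hw⟩ := Sym2.mem_iff_exists.1 hx
  by_cases hwP : w ∈ P
  · obtain ⟨z, hz, hs⟩ := ι.boundary s _ x.2 w hwP hw
    rw [he', Subtype.coe_eta, Sym2.congr_right] at hs
    exact absurd ⟨y, hs⟩ hz
  · have hs := ι.inner s _ _ x.2 hwP hw
    rw [he', Subtype.coe_eta, Sym2.congr_right] at hs
    obtain rfl := ι.ν_inj hs
    exact ⟨s, rfl, hw⟩

theorem link_of_link {x y : {x // x ∉ P}} (h : M.Link (ι.ν x) (ι.ν y)) : G.Link x y := by
  obtain ⟨e', he'⟩ := h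
  obtain ⟨s, -, hs⟩ := ι.exists_inner he'
  exact ⟨_, hs⟩

theorem exists_link_of_notMem_range {x : {x // x ∉ P}} {s : S} {q : V'}
    (h : M.ends (ι.ε s) = s(ι.ν x, q)) (hq : q ∉ Set.range ι.ν) :
    ∃ p ∈ P, G.ends (ι.τ s) = s(x.1, p) := by
  obtain ⟨s', hs', hx⟩ := ι.surj x _ (by rw [h]; exact Sym2.mem_mk_left _ _)
  obtain rfl := ι.ε_inj hs'
  obtain ⟨w, hw⟩ := Sym2.mem_iff_exists.1 hx
  by_cases hwP : w ∈ P
  · exact ⟨w, hwP, hw⟩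
  · have hs := ι.inner s' _ _ x.2 hwP hw
    rw [h, Subtype.coe_eta, Sym2.congr_right] at hs
    exact absurd ⟨_, hs.symm⟩ hq

theorem exists_link {x : {x // x ∉ P}} {q : V'} (h : M.Link (ι.ν x) q)
    (hq : q ∉ Set.range ι.ν) : ∃ p ∈ P, G.Link x p := by
  obtain ⟨e', he'⟩ := h
  obtain ⟨s, rfl, hx⟩ := ι.surj x e' (by rw [he']; exact Sym2.mem_mk_left _ _)
  obtain ⟨p, hp, h⟩ := ι.exists_link_of_notMem_range he' hq
  exact ⟨p, hp, _, h⟩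

/-- Edges leaving the open graph come from edges to `P`; `x` has only one neighbour there and `G`
has no parallel edges. -/
theorem edge_unique (hsc : G.ShortCycleFree)
    (hP : ∀ x ∉ P, ∀ p ∈ P, ∀ p' ∈ P, G.Link x p → G.Link x p' → p = p')
    {x : {x // x ∉ P}} {e e' : E'} {q q' : V'} (hq : q ∉ Set.range ι.ν) (hq' : q' ∉ Set.range ι.ν)
    (h : M.ends e = s(ι.ν x, q)) (h' : M.ends e' = s(ι.ν x, q')) : e = e' := by
  obtain ⟨s, rfl, -⟩ := ι.surj x e (by rw [h]; exact Sym2.mem_mk_left _ _)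
  obtain ⟨s', rfl, -⟩ := ι.surj x e' (by rw [h']; exact Sym2.mem_mk_left _ _)
  obtain ⟨p, hp, hs⟩ := ι.exists_link_of_notMem_range h hq
  obtain ⟨p', hp', hs'⟩ := ι.exists_link_of_notMem_range h' hq'
  obtain rfl := hP _ x.2 p hp p' hp' ⟨_, hs⟩ ⟨_, hs'⟩
  rw [ι.τ_inj (hsc.parallel _ _ (hs.trans hs'.symm))]

theorem eq_of_link (hsc : G.ShortCycleFree)
    (hP : ∀ x ∉ P, ∀ p ∈ P, ∀ p' ∈ P, G.Link x p → G.Link x p' → p = p')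
    {x : {x // x ∉ P}} {q q' : V'} (hq : q ∉ Set.range ι.ν) (hq' : q' ∉ Set.range ι.ν)
    (h : M.Link (ι.ν x) q) (h' : M.Link (ι.ν x) q') : q = q' := by
  obtain ⟨e, h⟩ := h
  obtain ⟨e', h'⟩ := h'
  obtain rfl := ι.edge_unique hsc hP hq hq' h h'
  exact Sym2.congr_right.1 (h.symm.trans h')

/-- An edge-cut which splits an open graph with at most five semiedges has at least two edges inside
of it. -/
theorem two_le_encard_inner [Finite V] (hc : G.IsCubic) (hg : G.GirthAtLeast 5)
    (h4 : G.CyclicallyEdgeConnected 4) (hPn : P.Nontrivial) (hP5 : (G.edgeCut P).encard ≤ 5)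
    (hP : ∀ x ∉ P, ∀ p ∈ P, ∀ p' ∈ P, G.Link x p → G.Link x p' → p = p')
    {X : Set V'} {a b : {x // x ∉ P}} (ha : ι.ν a ∈ X) (hb : ι.ν b ∉ X) :
    2 ≤ {e ∈ M.edgeCut X | ∀ v ∈ M.ends e, v ∈ Set.range ι.ν}.encard := by
  set C : Set E := {e | ∃ x y : {x // x ∉ P}, ι.ν x ∈ X ∧ ι.ν y ∉ X ∧ G.ends e = s(x.1, y.1)}
    with hC
  have hle : C.encard ≤ {e ∈ M.edgeCut X | ∀ v ∈ M.ends e, v ∈ Set.range ι.ν}.encard := by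
    refine ι.encard_le_of_forall ?_
    rintro e ⟨x, y, hx, hy, h⟩
    obtain ⟨s, rfl⟩ := ι.τ_surj e x.1 x.2 (by rw [h]; exact Sym2.mem_mk_left _ _)
    have hs := ι.inner s x.1 y.1 x.2 y.2 h
    refine ⟨s, rfl, ⟨_, hx, _, hy, hs⟩, ?_⟩
    intro v hv
    rw [hs, Sym2.mem_iff] at hv
    rcases hv with rfl | rfl <;> exact ⟨_, rfl⟩
  refine le_trans ?_ hle
  clear_value C
  clear hle
  let bd : Set {x // x ∉ P} → Set E := fun Y => {e | ∃ x ∈ Y, ∃ p ∈ P, G.ends e = s(x.1, p)}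
  let Y : Set {x // x ∉ P} := {x | ι.ν x ∈ X}
  -- `C` is the set of inner edges between the two sides, so it serves both `Y` and its complement.
  have hcut : ∀ Z : Set {x // x ∉ P}, (Z = Y ∨ Z = Yᶜ) →
      (G.edgeCut (Subtype.val '' Z)).encard ≤ C.encard + (bd Z).encard := by
    intro Z hZ
    refine le_trans (Set.encard_le_encard ?_) (Set.encard_union_le _ _)
    rintro e ⟨_, ⟨x, hx, rfl⟩, y, hy, h⟩
    by_cases hyP : y ∈ P
    · exact Or.inr ⟨x, hx, y, hyP, h⟩
    · left
      have hyZ : (⟨y, hyP⟩ : {x // x ∉ P}) ∉ Z := fun hyZ => hy ⟨_, hyZ, rfl⟩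
      rw [hC]
      rcases hZ with rfl | rfl
      · exact ⟨x, ⟨y, hyP⟩, hx, hyZ, h⟩
      · exact ⟨⟨y, hyP⟩, x, not_not.1 hyZ, hx, h.trans Sym2.eq_swap⟩
  -- A single vertex has at least three edges, and by `hP` at most one of them goes to `P`.
  have hsingle : ∀ Z : Set {x // x ∉ P}, (Z = Y ∨ Z = Yᶜ) → Z.Nonempty → Z.Subsingleton →
      2 ≤ C.encard := by
    intro Z hZ hne hsub
    obtain ⟨z, hz⟩ := hne
    obtain rfl := hsub.eq_singleton_of_mem hz
    have h1 := hcut _ hZ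
    rw [Set.image_singleton] at h1
    have h2 : (bd {z}).encard ≤ 1 := by
      rw [Set.encard_le_one_iff_subsingleton]
      rintro e ⟨x, hx, p, hp, h⟩ e' ⟨x', hx', p', hp', h'⟩
      rw [Set.mem_singleton_iff.1 hx] at h
      rw [Set.mem_singleton_iff.1 hx'] at h'
      obtain rfl := hP _ z.2 p hp p' hp' ⟨_, h⟩ ⟨_, h'⟩
      exact hg.shortCycleFree.parallel _ _ (h.trans h'.symm)
    have h3 : (2 : ℕ∞) + 1 ≤ C.encard + 1 := by
      calc (2 : ℕ∞) + 1 = 3 := by norm_num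
        _ ≤ _ := three_le_encard_edgeCut_singleton hc hg z.1
        _ ≤ _ := h1
        _ ≤ _ := by gcongr
    exact (ENat.add_le_add_iff_right (by simp)).1 h3
  have hlarge : ∀ Z : Set {x // x ∉ P}, (Z = Y ∨ Z = Yᶜ) → Z.Nontrivial →
      4 ≤ C.encard + (bd Z).encard := by
    intro Z hZ hnt
    refine le_trans ?_ (hcut Z hZ)
    refine four_le_encard_edgeCut hc hg h4 (hnt.image Subtype.val_injective) (hPn.mono ?_)
    rintro p hp ⟨x, -, rfl⟩
    exact x.2 hp
  rcases Set.subsingleton_or_nontrivial Y with hY | hY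
  · exact hsingle _ (Or.inl rfl) ⟨a, ha⟩ hY
  rcases Set.subsingleton_or_nontrivial Yᶜ with hY' | hY'
  · exact hsingle _ (Or.inr rfl) ⟨b, hb⟩ hY'
  have h1 := hlarge _ (Or.inl rfl) hY
  have h2 := hlarge _ (Or.inr rfl) hY'
  have h5 : (bd Y).encard + (bd Yᶜ).encard ≤ 5 := by
    rw [← Set.encard_union_eq]
    · refine le_trans (Set.encard_le_encard ?_) hP5
      rintro e (⟨x, -, p, hp, h⟩ | ⟨x, -, p, hp, h⟩) <;>
        exact ⟨p, hp, x.1, x.2, h.trans Sym2.eq_swap⟩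
    · rw [Set.disjoint_left]
      rintro e ⟨x, hx, p, hp, h⟩ ⟨x', hx', p', hp', h'⟩
      rw [h, Sym2.eq_iff] at h'
      rcases h' with ⟨h', -⟩ | ⟨h', -⟩
      · rw [Subtype.ext h'] at hx
        exact hx' hx
      · exact x.2 (h' ▸ hp')
  -- From $c+p\ge4$, $c+q\ge4$ and $p+q\le5$ follows $2c\ge3$, so $c\ge2$.
  generalize C.encard = c at *
  generalize (bd Y).encard = p at *
  generalize (bd Yᶜ).encard = q at *
  by_contra! hlt
  lift c to ℕ using hlt.ne_top
  have hp : p ≠ ⊤ := by rintro rfl; simp at h5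
  have hq : q ≠ ⊤ := by rintro rfl; simp at h5
  lift p to ℕ using hp
  lift q to ℕ using hq
  norm_cast at *
  omega

end OpenEmbedding

end Multigraph

namespace Multigraph

variable {V E V' E' : Type*} {G : Multigraph V E} {P : Set V} {M : Multigraph V' E'}

theorem map_keptEnds (e : G.Kept P) : (G.keptEnds P e).map Subtype.val = G.ends e.1 :=
  Sym2.attachWith_map_subtypeVal _

theorem keptEnds_eq {e : G.Kept P} {x y : V} (hx : x ∉ P) (hy : y ∉ P)
    (h : G.ends e.1 = s(x, y)) : G.keptEnds P e = s(⟨x, hx⟩, ⟨y, hy⟩) := by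
  apply Sym2.map.injective Subtype.val_injective
  rw [map_keptEnds, h]
  rfl

/-- The construction of an `OpenEmbedding` from the images of the surviving edges and of the
semiedges. -/
def OpenEmbedding.ofFreed {J : Type*} (pt : J → V) (hpt : Function.Injective pt)
    (hP : ∀ p, p ∈ P ↔ ∃ j, pt j = p) (ν : {x // x ∉ P} → V') (ν_inj : Function.Injective ν)
    (η : G.Kept P → E') (η_inj : Function.Injective η)
    (σ : (Σ j, G.Freed P (pt j)) → E') (σ_inj : Function.Injective σ)
    (hη : ∀ e, M.ends (η e) = (G.keptEnds P e).map ν)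
    (hσ : ∀ s, ∃ z ∉ Set.range ν, M.ends (σ s) = s(ν ⟨s.2.1.2, s.2.2.2⟩, z))
    (surj : ∀ x e', ν x ∈ M.ends e' → (∃ e, η e = e') ∨ ∃ s, σ s = e') :
    OpenEmbedding G P M (G.Kept P ⊕ Σ j, G.Freed P (pt j)) where
  ν := ν
  τ := Sum.elim (fun e => e.1) fun s => s.2.1.1
  ε := Sum.elim η σ
  ν_inj := ν_inj
  τ_inj := by
    have hPj : ∀ j, pt j ∈ P := fun j => (hP _).2 ⟨j, rfl⟩
    rintro (⟨e, he⟩ | ⟨j, ⟨e, x⟩, h, hx⟩) (⟨e', he'⟩ | ⟨j', ⟨e', x'⟩, h', hx'⟩) heq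
    · obtain rfl : e = e' := heq
      rfl
    · obtain rfl : e = e' := heq
      exact absurd (hPj j') (he _ (by rw [h']; exact Sym2.mem_mk_left _ _))
    · obtain rfl : e = e' := heq
      exact absurd (hPj j) (he' _ (by rw [h]; exact Sym2.mem_mk_left _ _))
    · obtain rfl : e = e' := heq
      have h2 := h.symm.trans h'
      rw [Sym2.eq_iff] at h2
      rcases h2 with ⟨h2, rfl⟩ | ⟨h2, h3⟩
      · obtain rfl := hpt h2
        rfl
      · exact absurd (hPj j) (h2 ▸ hx')
  ε_inj := by
    -- Images of surviving edges have both ends in the range of `ν`, images of semiedges do not.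
    have hne : ∀ e s, η e ≠ σ s := by
      intro e s h
      obtain ⟨z, hz, hs⟩ := hσ s
      have hz' : z ∈ M.ends (η e) := by
        rw [h, hs]
        exact Sym2.mem_mk_right _ _
      rw [hη, Sym2.mem_map] at hz'
      obtain ⟨a, -, rfl⟩ := hz'
      exact hz ⟨a, rfl⟩
    exact η_inj.sumElim σ_inj hne
  τ_surj := by
    intro e x hx hxe
    obtain ⟨y, hy⟩ := Sym2.mem_iff_exists.1 hxe
    by_cases hyP : y ∈ P
    · obtain ⟨j, rfl⟩ := (hP y).1 hyP
      exact ⟨Sum.inr ⟨j, ⟨(e, x), hy.trans Sym2.eq_swap, hx⟩⟩, rfl⟩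
    · refine ⟨Sum.inl ⟨e, fun z hz => ?_⟩, rfl⟩
      rw [hy, Sym2.mem_iff] at hz
      rcases hz with rfl | rfl <;> assumption
  inner := by
    rintro (e | ⟨j, ⟨e, w⟩, h', hw⟩) x y hx hy h
    · change M.ends (η e) = _
      rw [hη, keptEnds_eq hx hy h]
      rfl
    · have hj : pt j ∈ P := (hP _).2 ⟨j, rfl⟩
      have h2 : pt j ∈ s(x, y) := by
        rw [← h]
        exact Sym2.mem_iff_exists.2 ⟨w, h'⟩
      rw [Sym2.mem_iff] at h2
      rcases h2 with h2 | h2 <;> rw [h2] at hj <;> contradiction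
  boundary := by
    rintro (⟨e, he⟩ | ⟨j, ⟨e, w⟩, h', hw⟩) x hx p hp h
    · exact absurd hp (he p (h ▸ Sym2.mem_mk_right _ _))
    · have h2 : s(pt j, w) = s(x, p) := h'.symm.trans h
      rw [Sym2.eq_iff] at h2
      rcases h2 with ⟨h2, -⟩ | ⟨-, rfl⟩
      · exact absurd ((hP _).2 ⟨j, h2⟩) hx
      · exact hσ ⟨j, ⟨(e, w), h', hw⟩⟩
  surj := by
    intro x e' hx
    rcases surj x e' hx with ⟨e, rfl⟩ | ⟨s, rfl⟩
    · refine ⟨Sum.inl e, rfl, ?_⟩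
      rw [hη, Sym2.mem_map] at hx
      obtain ⟨a, ha, hax⟩ := hx
      obtain rfl := ν_inj hax
      change a.1 ∈ G.ends e.1
      rw [← map_keptEnds, Sym2.mem_map]
      exact ⟨a, ha, rfl⟩
    · refine ⟨Sum.inr s, rfl, ?_⟩
      obtain ⟨z, hz, hs⟩ := hσ s
      rw [hs, Sym2.mem_iff] at hx
      rcases hx with hx | hx
      · change x.1 ∈ G.ends s.2.1.1
        rw [ν_inj hx]
        exact Sym2.mem_iff_exists.2 ⟨_, s.2.2.1.trans Sym2.eq_swap⟩
      · exact absurd ⟨x, hx⟩ hz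

end Multigraph

/-! ### The poles as open graphs in the Halin snark. -/

namespace HalinSnark

open Multigraph

variable (X : HalinSnark.{u})

/-- The vertices removed from `G i`. -/
abbrev P (i : ZMod X.k) : Set (X.V i) := {X.a i, X.b i}

/-- The vertices removed from `G' i`. -/
abbrev P' (i : ZMod X.k) : Set (X.V' i) := {X.a' i, X.c' i, X.b' i}

abbrev DIn := Σ i, (X.G i).Freed (X.P i) (X.a i)
abbrev DOut := Σ i, (X.G i).Freed (X.P i) (X.b i)
abbrev BIn := Σ i, (X.G' i).Freed (X.P' i) (X.a' i)
abbrev BOut := Σ i, (X.G' i).Freed (X.P' i) (X.b' i)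
abbrev BRes := Σ i, (X.G' i).Freed (X.P' i) (X.c' i)

/-- The vertices of the Halin snark. -/
abbrev Vert := (Σ i, {x // x ∉ X.P i} ⊕ {x // x ∉ X.P' i}) ⊕ {w : X.W // w ∉ Set.range X.v}

/-- The edges of the Halin snark. -/
abbrev Edg := (Σ i, (X.G i).Kept (X.P i) ⊕ (X.G' i).Kept (X.P' i) ⊕ (X.G i).Freed (X.P i) (X.b i)) ⊕
  X.BOut ⊕ (X.S.induce {w | w ∉ Set.range X.v}).edgeSet ⊕
  (Σ i, Empty ⊕ (X.G' i).Freed (X.P' i) (X.c' i))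

variable {X}

def dVert (i : ZMod X.k) (x : {x // x ∉ X.P i}) : X.Vert := Sum.inl ⟨i, Sum.inl x⟩
def bVert (i : ZMod X.k) (x : {x // x ∉ X.P' i}) : X.Vert := Sum.inl ⟨i, Sum.inr x⟩
def tVert (w : {w : X.W // w ∉ Set.range X.v}) : X.Vert := Sum.inr w

def dInVert (s : X.DIn) : X.Vert := dVert s.1 ⟨s.2.1.2, s.2.2.2⟩
def dOutVert (s : X.DOut) : X.Vert := dVert s.1 ⟨s.2.1.2, s.2.2.2⟩
def bInVert (s : X.BIn) : X.Vert := bVert s.1 ⟨s.2.1.2, s.2.2.2⟩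
def bOutVert (s : X.BOut) : X.Vert := bVert s.1 ⟨s.2.1.2, s.2.2.2⟩
def bResVert (s : X.BRes) : X.Vert := bVert s.1 ⟨s.2.1.2, s.2.2.2⟩

/-- The letters `f` and `g` refer to the welding bijections, `t` to the tree, `r` to the residual
semiedges. -/
def dEdge (i : ZMod X.k) (e : (X.G i).Kept (X.P i)) : X.Edg := Sum.inl ⟨i, Sum.inl e⟩
def bEdge (i : ZMod X.k) (e : (X.G' i).Kept (X.P' i)) : X.Edg := Sum.inl ⟨i, Sum.inr (Sum.inl e)⟩
def fEdge (s : X.DOut) : X.Edg := Sum.inl ⟨s.1, Sum.inr (Sum.inr s.2)⟩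
def gEdge (s : X.BOut) : X.Edg := Sum.inr (Sum.inl s)
def tEdge (e : (X.S.induce {w | w ∉ Set.range X.v}).edgeSet) : X.Edg :=
  Sum.inr (Sum.inr (Sum.inl e))
def rEdge (s : X.BRes) : X.Edg := Sum.inr (Sum.inr (Sum.inr ⟨s.1, Sum.inr s.2⟩))

variable (X) in
/-- The welding inside of the Halin fragments. -/
def fEquiv : X.DOut ≃ X.BIn := Equiv.sigmaCongrRight X.f

variable (X) in
/-- The welding between consecutive Halin fragments. -/
def gEquiv : X.BOut ≃ X.DIn := Equiv.sigmaCongr (Equiv.addRight 1) X.g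

theorem edge_cases (e : X.Edg) : (∃ i e', e = dEdge i e') ∨ (∃ i e', e = bEdge i e') ∨
    (∃ s, e = fEdge s) ∨ (∃ s, e = gEdge s) ∨ (∃ e', e = tEdge e') ∨ ∃ s, e = rEdge s := by
  rcases e with ⟨i, e | e | s⟩ | s | e | ⟨i, s | s⟩
  · exact Or.inl ⟨i, e, rfl⟩
  · exact Or.inr (Or.inl ⟨i, e, rfl⟩)
  · exact Or.inr (Or.inr (Or.inl ⟨⟨i, s⟩, rfl⟩))
  · exact Or.inr (Or.inr (Or.inr (Or.inl ⟨s, rfl⟩)))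
  · exact Or.inr (Or.inr (Or.inr (Or.inr (Or.inl ⟨e, rfl⟩))))
  · exact s.elim
  · exact Or.inr (Or.inr (Or.inr (Or.inr (Or.inr ⟨⟨i, s⟩, rfl⟩))))

theorem ends_dEdge (i : ZMod X.k) (e) :
    X.graph.ends (dEdge i e) = ((X.G i).keptEnds (X.P i) e).map (dVert i) := by
  change Sym2.map _ (Sym2.map _ _) = _
  rw [Sym2.map_map]
  rfl

theorem ends_bEdge (i : ZMod X.k) (e) :
    X.graph.ends (bEdge i e) = ((X.G' i).keptEnds (X.P' i) e).map (bVert i) := by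
  change Sym2.map _ (Sym2.map _ _) = _
  rw [Sym2.map_map]
  rfl

theorem ends_fEdge (s : X.DOut) :
    X.graph.ends (fEdge s) = s(dOutVert s, bInVert (X.fEquiv s)) := rfl

theorem ends_gEdge (s : X.BOut) :
    X.graph.ends (gEdge s) = s(bOutVert s, dInVert (X.gEquiv s)) := rfl

theorem ends_tEdge (e) : X.graph.ends (tEdge e) = e.1.map tVert := rfl

theorem ends_rEdge (s : X.BRes) :
    X.graph.ends (rEdge s) = s(bResVert s, tVert (X.t s.1)) := rfl

/-- The decollineator (`false`) or bipartite pole (`true`) that contains the vertex, `none` for the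
vertices of the tree. -/
def lab : X.Vert → Option (ZMod X.k × Bool) :=
  Sum.elim (fun x => some (x.1, x.2.isRight)) fun _ => none

@[simp] theorem lab_dVert (i : ZMod X.k) (x) : lab (dVert i x) = some (i, false) := rfl
@[simp] theorem lab_bVert (i : ZMod X.k) (x) : lab (bVert i x) = some (i, true) := rfl
@[simp] theorem lab_tVert (w) : lab (tVert (X := X) w) = none := rfl
@[simp] theorem lab_dInVert (s : X.DIn) : lab (dInVert s) = some (s.1, false) := rfl
@[simp] theorem lab_dOutVert (s : X.DOut) : lab (dOutVert s) = some (s.1, false) := rfl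
@[simp] theorem lab_bInVert (s : X.BIn) : lab (bInVert s) = some (s.1, true) := rfl
@[simp] theorem lab_bOutVert (s : X.BOut) : lab (bOutVert s) = some (s.1, true) := rfl
@[simp] theorem lab_bResVert (s : X.BRes) : lab (bResVert s) = some (s.1, true) := rfl

theorem lab_eq_d {v : X.Vert} {i : ZMod X.k} : lab v = some (i, false) ↔ v ∈ Set.range (dVert i) := by
  constructor
  · rcases v with ⟨j, x | x⟩ | w
    · intro h
      obtain rfl : j = i := by simpa [lab] using h
      exact ⟨x, rfl⟩
    · intro h
      simp [lab] at h
    · intro h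
      simp [lab] at h
  · rintro ⟨x, rfl⟩
    rfl

theorem lab_eq_b {v : X.Vert} {i : ZMod X.k} : lab v = some (i, true) ↔ v ∈ Set.range (bVert i) := by
  constructor
  · rcases v with ⟨j, x | x⟩ | w
    · intro h
      simp [lab] at h
    · intro h
      obtain rfl : j = i := by simpa [lab] using h
      exact ⟨x, rfl⟩
    · intro h
      simp [lab] at h
  · rintro ⟨x, rfl⟩
    rfl

theorem lab_eq_none {v : X.Vert} : lab v = none ↔ v ∈ Set.range (tVert (X := X)) := by
  constructor
  · rcases v with ⟨j, x⟩ | w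
    · intro h
      simp [lab] at h
    · exact fun _ => ⟨w, rfl⟩
  · rintro ⟨x, rfl⟩
    rfl

theorem dVert_injective (i : ZMod X.k) : Function.Injective (dVert i) := by
  intro x y h
  simpa [dVert] using h

theorem bVert_injective (i : ZMod X.k) : Function.Injective (bVert i) := by
  intro x y h
  simpa [bVert] using h

/-- The point removed from `G i`: the input is at `false`, the output at `true`. -/
def dPt (i : ZMod X.k) (j : Bool) : X.V i := j.rec (X.a i) (X.b i)

/-- The points removed from `G' i`: the input is at `0`, the output at `1`, the residual semiedge at
`2`. -/
def bPt (i : ZMod X.k) : Fin 3 → X.V' i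
  | 0 => X.a' i
  | 1 => X.b' i
  | 2 => X.c' i

/-- Welded edges are indexed by the output semiedge in them, hence the inverse bijections at the
inputs, here and in `bSemi`. -/
def dSemi (i : ZMod X.k) : (Σ j, (X.G i).Freed (X.P i) (dPt i j)) → X.Edg
  | ⟨false, s⟩ => gEdge (X.gEquiv.symm ⟨i, s⟩)
  | ⟨true, s⟩ => fEdge ⟨i, s⟩

def bSemi (i : ZMod X.k) : (Σ j, (X.G' i).Freed (X.P' i) (bPt i j)) → X.Edg
  | ⟨0, s⟩ => fEdge (X.fEquiv.symm ⟨i, s⟩)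
  | ⟨1, s⟩ => gEdge ⟨i, s⟩
  | ⟨2, s⟩ => rEdge ⟨i, s⟩

theorem fEdge_injective : Function.Injective (fEdge (X := X)) := by
  rintro ⟨i, s⟩ ⟨j, t⟩ h
  simp only [fEdge, Sum.inl.injEq, Sigma.mk.injEq] at h
  obtain ⟨rfl, h⟩ := h
  simpa using h

theorem gEdge_injective : Function.Injective (gEdge (X := X)) := by
  intro s t h
  simpa [gEdge] using h

theorem rEdge_injective : Function.Injective (rEdge (X := X)) := by
  rintro ⟨i, s⟩ ⟨j, t⟩ h
  simp only [rEdge, Sum.inr.injEq, Sigma.mk.injEq] at h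
  obtain ⟨rfl, h⟩ := h
  simpa using h

/-- The decollineator `D i` in the Halin snark. -/
def dEmb (i : ZMod X.k) : OpenEmbedding (X.G i) (X.P i) X.graph
    ((X.G i).Kept (X.P i) ⊕ Σ j, (X.G i).Freed (X.P i) (dPt i j)) :=
  OpenEmbedding.ofFreed (dPt i)
    (by
      have := (X.adj_ab i).1
      rintro (_ | _) (_ | _) h <;> simp_all [dPt])
    (by
      intro p
      simp [dPt, eq_comm])
    (dVert i) (dVert_injective i) (dEdge i)
    (by
      intro e e' h
      simpa [dEdge] using h)
    (dSemi i)
    (by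
      rintro ⟨_ | _, s⟩ ⟨_ | _, t⟩ h
      · have := X.gEquiv.symm.injective (gEdge_injective h)
        obtain rfl := eq_of_heq (Sigma.mk.inj this).2
        rfl
      · simp [dSemi, fEdge, gEdge] at h
      · simp [dSemi, fEdge, gEdge] at h
      · have := fEdge_injective h
        obtain rfl := eq_of_heq (Sigma.mk.inj this).2
        rfl)
    (ends_dEdge i)
    (by
      rintro ⟨_ | _, s⟩
      · refine ⟨bOutVert (X.gEquiv.symm ⟨i, s⟩), by rw [← lab_eq_d]; simp, ?_⟩
        simp only [dSemi]
        rw [ends_gEdge, Equiv.apply_symm_apply, Sym2.eq_swap]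
        rfl
      · exact ⟨bInVert (X.fEquiv ⟨i, s⟩), by rw [← lab_eq_d]; simp, rfl⟩)
    (by
      -- Comparing labels of ends leaves the inner edges of $D_i$ and the welded edges on its two
      -- connectors.
      intro x e' hx
      rcases edge_cases e' with ⟨j, e, rfl⟩ | ⟨j, e, rfl⟩ | ⟨s, rfl⟩ | ⟨s, rfl⟩ | ⟨e, rfl⟩ | ⟨s, rfl⟩
      · rw [ends_dEdge, Sym2.mem_map] at hx
        obtain ⟨y, -, h⟩ := hx
        obtain rfl : j = i := by simpa using congrArg lab h
        exact Or.inl ⟨e, rfl⟩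
      · rw [ends_bEdge, Sym2.mem_map] at hx
        obtain ⟨y, -, h⟩ := hx
        simpa using congrArg lab h
      · rw [ends_fEdge, Sym2.mem_iff] at hx
        rcases hx with h | h
        · obtain ⟨j, s⟩ := s
          obtain rfl : i = j := by simpa using congrArg lab h
          exact Or.inr ⟨⟨true, s⟩, rfl⟩
        · simpa using congrArg lab h
      · obtain ⟨⟨j, s⟩, rfl⟩ := X.gEquiv.symm.surjective s
        rw [ends_gEdge, Sym2.mem_iff, Equiv.apply_symm_apply] at hx
        rcases hx with h | h
        · simpa using congrArg lab h
        · obtain rfl : i = j := by simpa using congrArg lab h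
          exact Or.inr ⟨⟨false, s⟩, rfl⟩
      · rw [ends_tEdge, Sym2.mem_map] at hx
        obtain ⟨y, -, h⟩ := hx
        simpa using congrArg lab h
      · rw [ends_rEdge, Sym2.mem_iff] at hx
        rcases hx with h | h <;> simpa using congrArg lab h)

/-- The bipartite pole `B i` in the Halin snark. -/
def bEmb (i : ZMod X.k) : OpenEmbedding (X.G' i) (X.P' i) X.graph
    ((X.G' i).Kept (X.P' i) ⊕ Σ j, (X.G' i).Freed (X.P' i) (bPt i j)) :=
  OpenEmbedding.ofFreed (bPt i)
    (by
      have h1 := (X.adj_ac' i).1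
      have h2 := (X.adj_cb' i).1
      have h3 := X.ne_ab' i
      intro j j' h
      fin_cases j <;> fin_cases j' <;> simp_all [bPt])
    (by
      intro p
      simp only [Set.mem_insert_iff, Set.mem_singleton_iff, Fin.exists_fin_succ, bPt]
      simp [eq_comm]
      tauto)
    (bVert i) (bVert_injective i) (bEdge i)
    (by
      intro e e' h
      simpa [bEdge] using h)
    (bSemi i)
    (by
      rintro ⟨j, s⟩ ⟨j', t⟩ h
      match j, j', s, t, h with
      | 0, 0, s, t, h =>
        have := X.fEquiv.symm.injective (fEdge_injective h)
        obtain rfl := eq_of_heq (Sigma.mk.inj this).2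
        rfl
      | 1, 1, s, t, h =>
        have := gEdge_injective h
        obtain rfl := eq_of_heq (Sigma.mk.inj this).2
        rfl
      | 2, 2, s, t, h =>
        have := rEdge_injective h
        obtain rfl := eq_of_heq (Sigma.mk.inj this).2
        rfl
      | 0, 1, s, t, h | 0, 2, s, t, h | 1, 0, s, t, h | 1, 2, s, t, h | 2, 0, s, t, h
      | 2, 1, s, t, h => simp [bSemi, fEdge, gEdge, rEdge] at h)
    (ends_bEdge i)
    (by
      rintro ⟨j, s⟩
      match j, s with
      | 0, s =>
        refine ⟨dOutVert (X.fEquiv.symm ⟨i, s⟩), by rw [← lab_eq_b]; simp, ?_⟩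
        simp only [bSemi]
        rw [ends_fEdge, Equiv.apply_symm_apply, Sym2.eq_swap]
        rfl
      | 1, s => exact ⟨dInVert (X.gEquiv ⟨i, s⟩), by rw [← lab_eq_b]; simp, rfl⟩
      | 2, s => exact ⟨tVert (X.t i), by rw [← lab_eq_b]; simp, rfl⟩)
    (by
      intro x e' hx
      rcases edge_cases e' with ⟨j, e, rfl⟩ | ⟨j, e, rfl⟩ | ⟨s, rfl⟩ | ⟨s, rfl⟩ | ⟨e, rfl⟩ | ⟨s, rfl⟩
      · rw [ends_dEdge, Sym2.mem_map] at hx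
        obtain ⟨y, -, h⟩ := hx
        simpa using congrArg lab h
      · rw [ends_bEdge, Sym2.mem_map] at hx
        obtain ⟨y, -, h⟩ := hx
        obtain rfl : j = i := by simpa using congrArg lab h
        exact Or.inl ⟨e, rfl⟩
      · obtain ⟨⟨j, s⟩, rfl⟩ := X.fEquiv.symm.surjective s
        rw [ends_fEdge, Sym2.mem_iff, Equiv.apply_symm_apply] at hx
        rcases hx with h | h
        · simpa using congrArg lab h
        · obtain rfl : i = j := by simpa using congrArg lab h
          exact Or.inr ⟨⟨0, s⟩, rfl⟩
      · rw [ends_gEdge, Sym2.mem_iff] at hx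
        rcases hx with h | h
        · obtain ⟨j, s⟩ := s
          obtain rfl : i = j := by simpa using congrArg lab h
          exact Or.inr ⟨⟨1, s⟩, rfl⟩
        · simpa using congrArg lab h
      · rw [ends_tEdge, Sym2.mem_map] at hx
        obtain ⟨y, -, h⟩ := hx
        simpa using congrArg lab h
      · rw [ends_rEdge, Sym2.mem_iff] at hx
        rcases hx with h | h
        · obtain ⟨j, s⟩ := s
          obtain rfl : i = j := by simpa using congrArg lab h
          exact Or.inr ⟨⟨2, s⟩, rfl⟩
        · simpa using congrArg lab h)

end HalinSnark

/-! ### Acyclic graphs, and removed paths in graphs without short cycles. -/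

namespace Multigraph

/-- An acyclic simple graph has no cycles as a multigraph. -/
theorem not_hasCycleIn_of_isAcyclic {W : Type*} {H : SimpleGraph W} (hH : H.IsAcyclic) (Y : Set W)
    (n : ℕ) : ¬ (⟨fun e => e.1⟩ : Multigraph W H.edgeSet).HasCycleIn Y n := by
  rintro ⟨hn, x, e, hx, he, -, hc⟩
  change ∀ i, (e i).1 = s(x i, x (i + 1)) at hc
  have hadj : ∀ i, H.Adj (x i) (x (i + 1)) := fun i => by
    rw [← SimpleGraph.mem_edgeSet, ← hc i]
    exact (e i).2
  obtain rfl | rfl | ⟨m, rfl⟩ : n = 1 ∨ n = 2 ∨ ∃ m, n = m + 3 :=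
    if h : 3 ≤ n then Or.inr (Or.inr ⟨n - 3, by omega⟩) else by omega
  · exact H.loopless.irrefl _ (hadj 0)
  · have : (0 : ZMod 2) = 1 := he (Subtype.ext (by
      rw [hc 0, hc 1, show (1 + 1 : ZMod 2) = 0 from rfl, zero_add]
      exact Sym2.eq_swap))
    exact absurd this (by decide)
  -- A cycle of length at least 3 is a copy of `cycleGraph`, which an acyclic graph does not
  -- contain.
  · have hadj' : ∀ i j : ZMod (m + 3), i - j = 1 → H.Adj (x j) (x i) := by
      intro i j hij
      rw [show i = j + 1 by rw [← hij]; ring]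
      exact hadj j
    refine SimpleGraph.isAcyclic_iff_free_cycleGraph.1 hH (m + 3) (by omega)
      ⟨⟨⟨x, fun {i j} hij => ?_⟩, hx⟩⟩
    rw [SimpleGraph.cycleGraph_adj] at hij
    rcases hij with hij | hij
    · exact (hadj' i j hij).symm
    · exact hadj' j i hij

variable {V E : Type*} {G : Multigraph V E}

/-- Two neighbours on the edge would close a triangle; on a path of length 2, as in the next lemma,
a triangle or a quadrangle. -/
theorem ShortCycleFree.eq_of_link_edge (h : G.ShortCycleFree) {a b : V} (hab : G.Link a b) :
    ∀ x ∉ ({a, b} : Set V), ∀ p ∈ ({a, b} : Set V), ∀ p' ∈ ({a, b} : Set V),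
      G.Link x p → G.Link x p' → p = p' := by
  rintro x - p (rfl | rfl) p' (rfl | rfl) h1 h2
  · rfl
  · exact (h.triangle _ _ _ h1 hab h2.symm).elim
  · exact (h.triangle _ _ _ h2 hab h1.symm).elim
  · rfl

theorem ShortCycleFree.eq_of_link_path (h : G.ShortCycleFree) {a c b : V} (hac : G.Link a c)
    (hcb : G.Link c b) (hne : a ≠ b) :
    ∀ x ∉ ({a, c, b} : Set V), ∀ p ∈ ({a, c, b} : Set V), ∀ p' ∈ ({a, c, b} : Set V),
      G.Link x p → G.Link x p' → p = p' := by
  rintro x hx p (rfl | rfl | rfl) p' (rfl | rfl | rfl) h1 h2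
  · rfl
  · exact (h.triangle _ _ _ h1 hac h2.symm).elim
  · exact (h.quad x _ _ _ (fun h => hx (by simp [h])) hne h1 hac hcb h2.symm).elim
  · exact (h.triangle _ _ _ h2 hac h1.symm).elim
  · rfl
  · exact (h.triangle _ _ _ h1 hcb h2.symm).elim
  · exact (h.quad x _ _ _ (fun h => hx (by simp [h])) hne h2 hac hcb h1.symm).elim
  · exact (h.triangle _ _ _ h2 hcb h1.symm).elim
  · rfl

theorem ShortCycleFree.not_link_of_link_edge (h : G.ShortCycleFree) {a b : V} (hab : G.Link a b)
    {x y p p' : V} (hx : x ∉ ({a, b} : Set V)) (hy : y ∉ ({a, b} : Set V))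
    (hp : p ∈ ({a, b} : Set V)) (hp' : p' ∈ ({a, b} : Set V)) (h1 : G.Link x p)
    (h2 : G.Link y p') : ¬ G.Link x y := by
  intro hxy
  by_cases hpp : p = p'
  · subst hpp
    exact h.triangle _ _ _ hxy h2 h1.symm
  · have hl : G.Link p' p := by
      rcases hp with rfl | rfl <;> rcases hp' with rfl | rfl
      exacts [absurd rfl hpp, hab.symm, hab, absurd rfl hpp]
    refine h.quad x y p' p ?_ ?_ hxy h2 hl h1.symm
    · rintro rfl
      exact hx hp'
    · rintro rfl
      exact hy hp

/-- One vertex has to be attached to the middle `c`: attachments at `a` and `b` would only give a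
cycle of length 5. -/
theorem ShortCycleFree.not_link_of_link_path (h : G.ShortCycleFree) {a c b : V} (hac : G.Link a c)
    (hcb : G.Link c b) {x y p : V} (hx : x ∉ ({a, c, b} : Set V)) (hy : y ∉ ({a, c, b} : Set V))
    (hp : p ∈ ({a, c, b} : Set V)) (h1 : G.Link x c) (h2 : G.Link y p) : ¬ G.Link x y := by
  intro hxy
  have hxp : x ≠ p := by
    rintro rfl
    exact hx hp
  have hyc : y ≠ c := by
    rintro rfl
    exact hy (by simp)
  rcases hp with rfl | rfl | rfl
  · exact h.quad _ _ _ _ hxp hyc hxy h2 hac h1.symm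
  · exact h.triangle _ _ _ hxy h2 h1.symm
  · exact h.quad _ _ _ _ hxp hyc hxy h2 hcb.symm h1.symm

end Multigraph

/-! ### Edges between the parts, and the girth of the Halin snark. -/

namespace HalinSnark

open Multigraph

variable {X : HalinSnark.{u}}

theorem link_ab (i : ZMod X.k) : (X.G i).Link (X.a i) (X.b i) := (X.adj_ab i).2
theorem link_ac' (i : ZMod X.k) : (X.G' i).Link (X.a' i) (X.c' i) := (X.adj_ac' i).2
theorem link_cb' (i : ZMod X.k) : (X.G' i).Link (X.c' i) (X.b' i) := (X.adj_cb' i).2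

theorem edge_of_lab_ne {e : X.Edg} {x y : X.Vert} (h : X.graph.ends e = s(x, y))
    (hne : lab x ≠ lab y) : (∃ s, e = fEdge s) ∨ (∃ s, e = gEdge s) ∨ ∃ s, e = rEdge s := by
  rcases edge_cases e with ⟨j, e, rfl⟩ | ⟨j, e, rfl⟩ | hs | hs | ⟨e, rfl⟩ | hs
  · have hx : x ∈ X.graph.ends (dEdge j e) := h ▸ Sym2.mem_mk_left _ _
    have hy : y ∈ X.graph.ends (dEdge j e) := h ▸ Sym2.mem_mk_right _ _
    rw [ends_dEdge, Sym2.mem_map] at hx hy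
    obtain ⟨x, -, rfl⟩ := hx
    obtain ⟨y, -, rfl⟩ := hy
    exact absurd rfl hne
  · have hx : x ∈ X.graph.ends (bEdge j e) := h ▸ Sym2.mem_mk_left _ _
    have hy : y ∈ X.graph.ends (bEdge j e) := h ▸ Sym2.mem_mk_right _ _
    rw [ends_bEdge, Sym2.mem_map] at hx hy
    obtain ⟨x, -, rfl⟩ := hx
    obtain ⟨y, -, rfl⟩ := hy
    exact absurd rfl hne
  · exact Or.inl hs
  · exact Or.inr (Or.inl hs)
  · have hx : x ∈ X.graph.ends (tEdge e) := h ▸ Sym2.mem_mk_left _ _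
    have hy : y ∈ X.graph.ends (tEdge e) := h ▸ Sym2.mem_mk_right _ _
    rw [ends_tEdge, Sym2.mem_map] at hx hy
    obtain ⟨x, -, rfl⟩ := hx
    obtain ⟨y, -, rfl⟩ := hy
    exact absurd rfl hne
  · exact Or.inr (Or.inr hs)

/-- The edges between the tree and the fragments. -/
theorem edge_of_lab_eq_none {e : X.Edg} {x y : X.Vert} (h : X.graph.ends e = s(x, y))
    (hx : lab x ≠ none) (hy : lab y = none) : ∃ s, e = rEdge s ∧ x = bResVert s := by
  rcases edge_of_lab_ne h (by rwa [hy]) with ⟨s, rfl⟩ | ⟨s, rfl⟩ | ⟨s, rfl⟩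
  · rw [ends_fEdge, Sym2.eq_iff] at h
    rcases h with ⟨-, rfl⟩ | ⟨rfl, -⟩ <;> simp at hy
  · rw [ends_gEdge, Sym2.eq_iff] at h
    rcases h with ⟨-, rfl⟩ | ⟨rfl, -⟩ <;> simp at hy
  · rw [ends_rEdge, Sym2.eq_iff] at h
    rcases h with ⟨rfl, -⟩ | ⟨-, rfl⟩
    · exact ⟨s, rfl, rfl⟩
    · simp at hx

theorem res_unique {s t : X.BRes} (h : s.1 = t.1) : s = t := by
  obtain ⟨i, s⟩ := s
  obtain ⟨j, t⟩ := t
  obtain rfl : i = j := h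
  have h1 : ENat.card ((X.G' i).Freed (X.P' i) (X.c' i)) = 1 := by
    have := (X.isPole_B i).2.2
    exact_mod_cast this
  have : Subsingleton ((X.G' i).Freed (X.P' i) (X.c' i)) :=
    (ENat.card_le_one_iff_subsingleton _).1 h1.le
  rw [Subsingleton.elim s t]

/-- Edges between different fragment parts join a decollineator with a bipartite pole. -/
theorem snd_ne_of_link {x y : X.Vert} {p q : ZMod X.k × Bool} (h : X.graph.Link x y)
    (hx : lab x = some p) (hy : lab y = some q) (hne : p ≠ q) : p.2 ≠ q.2 := by
  obtain ⟨e, h⟩ := h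
  rcases edge_of_lab_ne h (by simpa [hx, hy]) with ⟨s, rfl⟩ | ⟨s, rfl⟩ | ⟨s, rfl⟩
  · rw [ends_fEdge, Sym2.eq_iff] at h
    rcases h with ⟨rfl, rfl⟩ | ⟨rfl, rfl⟩ <;> simp at hx hy <;> subst hx hy <;> simp
  · rw [ends_gEdge, Sym2.eq_iff] at h
    rcases h with ⟨rfl, rfl⟩ | ⟨rfl, rfl⟩ <;> simp at hx hy <;> subst hx hy <;> simp
  · rw [ends_rEdge, Sym2.eq_iff] at h
    rcases h with ⟨rfl, rfl⟩ | ⟨rfl, rfl⟩ <;> simp at hx hy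

/-- The tree of the Halin snark. -/
def tree (X : HalinSnark.{u}) : Multigraph {w : X.W // w ∉ Set.range X.v}
    (X.S.induce {w | w ∉ Set.range X.v}).edgeSet := ⟨fun e => e.1⟩

theorem not_hasCycleIn_tree (Y) (n : ℕ) : ¬ X.tree.HasCycleIn Y n :=
  not_hasCycleIn_of_isAcyclic (X.isHalin.isTree.isAcyclic.induce _) Y n

theorem tVert_injective : Function.Injective (tVert (X := X)) := Sum.inr_injective

theorem edge_of_lab_eq_none_of_lab_eq_none {e : X.Edg} {x y : {w : X.W // w ∉ Set.range X.v}}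
    (h : X.graph.ends e = s(tVert x, tVert y)) : ∃ e', e = tEdge e' ∧ X.tree.ends e' = s(x, y) := by
  have hx : tVert x ∈ X.graph.ends e := h ▸ Sym2.mem_mk_left _ _
  have hy : tVert y ∈ X.graph.ends e := h ▸ Sym2.mem_mk_right _ _
  rcases edge_cases e with ⟨j, e, rfl⟩ | ⟨j, e, rfl⟩ | ⟨s, rfl⟩ | ⟨s, rfl⟩ | ⟨e, rfl⟩ | ⟨s, rfl⟩
  · rw [ends_dEdge, Sym2.mem_map] at hx
    obtain ⟨y, -, h⟩ := hx
    simpa using congrArg lab h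
  · rw [ends_bEdge, Sym2.mem_map] at hx
    obtain ⟨y, -, h⟩ := hx
    simpa using congrArg lab h
  · rw [ends_fEdge, Sym2.mem_iff] at hx
    rcases hx with h | h <;> simpa using congrArg lab h
  · rw [ends_gEdge, Sym2.mem_iff] at hx
    rcases hx with h | h <;> simpa using congrArg lab h
  · refine ⟨e, rfl, Sym2.map.injective tVert_injective ?_⟩
    rw [Sym2.map_mk]
    exact h
  · rw [ends_rEdge, Sym2.eq_iff] at h
    rcases h with ⟨h, -⟩ | ⟨h, -⟩ <;> simpa using congrArg lab h

theorem not_hasCycleIn_of_lab_eq_none {Y : Set X.Vert} (hY : ∀ v ∈ Y, lab v = none) (n : ℕ) :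
    ¬ X.graph.HasCycleIn Y n := by
  rintro ⟨hn, x, e, hx, he, hxY, hc⟩
  choose w hw using fun i => lab_eq_none.1 (hY _ (hxY i))
  have h : ∀ i, ∃ e', e i = tEdge e' ∧ X.tree.ends e' = s(w i, w (i + 1)) := fun i =>
    edge_of_lab_eq_none_of_lab_eq_none (by rw [hc, hw, hw])
  choose e' he' hc' using h
  refine not_hasCycleIn_tree Set.univ n ⟨hn, w, e', ?_, ?_, fun _ => trivial, hc'⟩
  · intro i j hij
    exact hx (by rw [← hw i, ← hw j, hij])
  · intro i j hij
    exact he (by rw [he' i, he' j, hij])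

theorem tree_shortCycleFree : X.tree.ShortCycleFree :=
  GirthAtLeast.shortCycleFree fun n h => absurd h (not_hasCycleIn_tree _ n)

section Girth

variable (hD : ∀ i, (X.G i).ShortCycleFree) (hB : ∀ i, (X.G' i).ShortCycleFree)

include hD hB in
-- Two edges leaving the pole at the same vertex would give this vertex two neighbours on the
-- removed path.
theorem edge_unique_of_lab_ne {x y z : X.Vert} {e e' : X.Edg} (hx : lab x ≠ none)
    (h : X.graph.ends e = s(x, y)) (h' : X.graph.ends e' = s(x, z)) (hy : lab y ≠ lab x)
    (hz : lab z ≠ lab x) : e = e' := by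
  obtain ⟨⟨i, b⟩, hi⟩ := Option.ne_none_iff_exists'.1 hx
  rw [hi] at hy hz
  cases b
  · obtain ⟨x, rfl⟩ := lab_eq_d.1 hi
    rw [Ne, lab_eq_d] at hy hz
    exact (dEmb i).edge_unique (hD i) ((hD i).eq_of_link_edge (link_ab i)) hy hz h h'
  · obtain ⟨x, rfl⟩ := lab_eq_b.1 hi
    rw [Ne, lab_eq_b] at hy hz
    exact (bEmb i).edge_unique (hB i)
      ((hB i).eq_of_link_path (link_ac' i) (link_cb' i) (X.ne_ab' i)) hy hz h h'

include hD hB in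
-- The form used on cycles: if one neighbour on the cycle is in another part, the other one is not.
theorem lab_eq_of_link {x y z : X.Vert} (hx : lab x ≠ none)
    (h : X.graph.Link x y) (h' : X.graph.Link x z) (hy : lab y ≠ lab x) (hyz : y ≠ z) :
    lab z = lab x := by
  by_contra hz
  obtain ⟨e, h⟩ := h
  obtain ⟨e', h'⟩ := h'
  obtain rfl := edge_unique_of_lab_ne hD hB hx h h' hy hz
  exact hyz (Sym2.congr_right.1 (h.symm.trans h'))

include hD in
theorem not_link_of_lab_d {i : ZMod X.k} {x y z w : X.Vert} (hx : lab x = some (i, false))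
    (hy : lab y = some (i, false)) (hxz : X.graph.Link x z) (hz : lab z ≠ lab x)
    (hyw : X.graph.Link y w) (hw : lab w ≠ lab y) : ¬ X.graph.Link x y := by
  rw [hx] at hz
  rw [hy] at hw
  rw [Ne, lab_eq_d] at hz hw
  obtain ⟨x, rfl⟩ := lab_eq_d.1 hx
  obtain ⟨y, rfl⟩ := lab_eq_d.1 hy
  obtain ⟨p, hp, hxp⟩ := (dEmb i).exists_link hxz hz
  obtain ⟨q, hq, hyq⟩ := (dEmb i).exists_link hyw hw
  intro h
  exact (hD i).not_link_of_link_edge (link_ab i) x.2 y.2 hp hq hxp hyq ((dEmb i).link_of_link h)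

include hB in
-- The neighbour `z` in the tree makes `x` the vertex at the residual semiedge, so in $G'_i$ it is
-- attached to the middle of the removed path.
theorem not_link_of_lab_b {i : ZMod X.k} {x y z w : X.Vert} (hx : lab x = some (i, true))
    (hy : lab y = some (i, true)) (hxz : X.graph.Link x z) (hz : lab z = none)
    (hyw : X.graph.Link y w) (hw : lab w ≠ lab y) : ¬ X.graph.Link x y := by
  rw [hy] at hw
  rw [Ne, lab_eq_b] at hw
  obtain ⟨e, he⟩ := hxz
  obtain ⟨⟨j, s⟩, rfl, rfl⟩ := edge_of_lab_eq_none he (by simp [hx]) hz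
  obtain rfl : j = i := by simpa using hx
  obtain ⟨y, rfl⟩ := lab_eq_b.1 hy
  obtain ⟨q, hq, hyq⟩ := (bEmb j).exists_link hyw hw
  intro h
  exact (hB j).not_link_of_link_path (link_ac' j) (link_cb' j) (x := s.1.2) s.2.2 y.2 hq
    ⟨s.1.1, s.2.1.trans Sym2.eq_swap⟩ hyq ((bEmb j).link_of_link h)

theorem lab_snd_of_link_none {x y : X.Vert} (h : X.graph.Link x y) (hx : lab x ≠ none)
    (hy : lab y = none) : ∃ i, lab x = some (i, true) := by
  obtain ⟨e, he⟩ := h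
  obtain ⟨s, rfl, rfl⟩ := edge_of_lab_eq_none he hx hy
  exact ⟨s.1, rfl⟩

theorem eq_of_link_none {x y z w : X.Vert} (h : X.graph.Link x z) (h' : X.graph.Link y w)
    (hx : lab x ≠ none) (hxy : lab x = lab y) (hz : lab z = none) (hw : lab w = none) : x = y := by
  obtain ⟨e, he⟩ := h
  obtain ⟨e', he'⟩ := h'
  obtain ⟨s, rfl, rfl⟩ := edge_of_lab_eq_none he hx hz
  obtain ⟨t, rfl, rfl⟩ := edge_of_lab_eq_none he' (hxy ▸ hx) hw
  exact congrArg bResVert (res_unique (by simpa using hxy))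

include hD hB in
theorem graph_loop (x : X.Vert) : ¬ X.graph.Link x x := by
  intro h
  rcases x with ⟨i, x | x⟩ | x
  · exact (hD i).loop _ ((dEmb i).link_of_link (x := x) (y := x) h)
  · exact (hB i).loop _ ((bEmb i).link_of_link (x := x) (y := x) h)
  · obtain ⟨e, he⟩ := h
    obtain ⟨e', rfl, h'⟩ := edge_of_lab_eq_none_of_lab_eq_none he
    exact tree_shortCycleFree.loop x ⟨e', h'⟩

include hD hB in
theorem graph_parallel (e e' : X.Edg) (h : X.graph.ends e = X.graph.ends e') : e = e' := by
  obtain ⟨x, y, hxy⟩ : ∃ x y, X.graph.ends e = s(x, y) := by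
    induction hs : X.graph.ends e using Sym2.ind with | _ x y => exact ⟨x, y, rfl⟩
  have hxy' := h.symm.trans hxy
  by_cases hlab : lab x = lab y
  · cases hx : lab x with
    | none =>
      obtain ⟨x, rfl⟩ := lab_eq_none.1 hx
      obtain ⟨y, rfl⟩ := lab_eq_none.1 (hlab ▸ hx)
      obtain ⟨f, rfl, hf⟩ := edge_of_lab_eq_none_of_lab_eq_none hxy
      obtain ⟨f', rfl, hf'⟩ := edge_of_lab_eq_none_of_lab_eq_none hxy'
      exact congrArg tEdge (tree_shortCycleFree.parallel _ _ (hf.trans hf'.symm))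
    | some ib =>
      obtain ⟨i, b⟩ := ib
      cases b
      · obtain ⟨x, rfl⟩ := lab_eq_d.1 hx
        obtain ⟨y, rfl⟩ := lab_eq_d.1 (hlab ▸ hx)
        obtain ⟨s, rfl, hs⟩ := (dEmb i).exists_inner hxy
        obtain ⟨s', rfl, hs'⟩ := (dEmb i).exists_inner hxy'
        rw [(dEmb i).τ_inj ((hD i).parallel _ _ (hs.trans hs'.symm))]
      · obtain ⟨x, rfl⟩ := lab_eq_b.1 hx
        obtain ⟨y, rfl⟩ := lab_eq_b.1 (hlab ▸ hx)
        obtain ⟨s, rfl, hs⟩ := (bEmb i).exists_inner hxy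
        obtain ⟨s', rfl, hs'⟩ := (bEmb i).exists_inner hxy'
        rw [(bEmb i).τ_inj ((hB i).parallel _ _ (hs.trans hs'.symm))]
  · by_cases hx : lab x = none
    · exact edge_unique_of_lab_ne hD hB (fun hy => hlab (hx.trans hy.symm))
        (hxy.trans Sym2.eq_swap) (hxy'.trans Sym2.eq_swap) hlab hlab
    · exact edge_unique_of_lab_ne hD hB hx hxy hxy' (Ne.symm hlab) (Ne.symm hlab)

include hD hB in
theorem triangle_tree {x y z : X.Vert} (hx : lab x = none) (hy : lab y ≠ none)
    (hxy : X.graph.Link x y) (hyz : X.graph.Link y z) (hzx : X.graph.Link z x) : False := by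
  have hzy : lab z = lab y := lab_eq_of_link hD hB hy hxy.symm hyz (by rw [hx]; exact hy.symm)
    (by rintro rfl; exact graph_loop hD hB _ hzx)
  obtain ⟨i, hi⟩ := lab_snd_of_link_none hxy.symm hy hx
  exact not_link_of_lab_b hB hi (hzy.trans hi) hxy.symm hx hzx (by rw [hzy, hx]; exact hy.symm) hyz

include hD hB in
-- Outside of the tree, `z` would have to share the part of `x` and that of `y`.
theorem triangle_cross {x y z : X.Vert} (hne : lab x ≠ lab y)
    (hxy : X.graph.Link x y) (hyz : X.graph.Link y z) (hzx : X.graph.Link z x) : False := by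
  by_cases hx : lab x = none
  · exact triangle_tree hD hB hx (fun h => hne (hx.trans h.symm)) hxy hyz hzx
  by_cases hy : lab y = none
  · exact triangle_tree hD hB hy hx hxy.symm hzx.symm hyz.symm
  have h1 : lab z = lab x := lab_eq_of_link hD hB hx hxy hzx.symm hne.symm
    (by rintro rfl; exact graph_loop hD hB _ hyz)
  have h2 : lab z = lab y := lab_eq_of_link hD hB hy hxy.symm hyz hne
    (by rintro rfl; exact graph_loop hD hB _ hzx)
  exact hne (h1.symm.trans h2)

include hD hB in
-- Both `y` and `z` are in some $B_i$, with `y` at the residual semiedge. If `w` is there too, it is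
-- a second such vertex; if not, the adjacent `y` and `z` both have edges leaving $B_i$.
theorem quad_tree {x y z w : X.Vert} (hx : lab x = none) (hy : lab y ≠ none) (hxz : x ≠ z)
    (hyw : y ≠ w) (hxy : X.graph.Link x y) (hyz : X.graph.Link y z) (hzw : X.graph.Link z w)
    (hwx : X.graph.Link w x) : False := by
  have hzy : lab z = lab y := lab_eq_of_link hD hB hy hxy.symm hyz (by rw [hx]; exact hy.symm) hxz
  obtain ⟨i, hi⟩ := lab_snd_of_link_none hxy.symm hy hx
  by_cases hw : lab w = lab z
  · exact hyw (eq_of_link_none hxy.symm hwx hy (hzy.symm.trans hw.symm) hx hx)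
  · exact not_link_of_lab_b hB hi (hzy.trans hi) hxy.symm hx hzw hw hyz

include hD hB in
-- Away from the tree, `x`, `w` are in one pole and `y`, `z` in another; one of the two is a
-- decollineator and has adjacent vertices with edges leaving it.
theorem quad_cross {x y z w : X.Vert} (hne : lab x ≠ lab y) (hxz : x ≠ z)
    (hyw : y ≠ w) (hxy : X.graph.Link x y) (hyz : X.graph.Link y z) (hzw : X.graph.Link z w)
    (hwx : X.graph.Link w x) : False := by
  by_cases hx : lab x = none
  · exact quad_tree hD hB hx (fun h => hne (hx.trans h.symm)) hxz hyw hxy hyz hzw hwx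
  by_cases hy : lab y = none
  · exact quad_tree hD hB hy hx hyw hxz hxy.symm hwx.symm hzw.symm hyz.symm
  have h1 : lab w = lab x := lab_eq_of_link hD hB hx hxy hwx.symm hne.symm hyw
  have h2 : lab z = lab y := lab_eq_of_link hD hB hy hxy.symm hyz hne hxz
  obtain ⟨⟨i, b⟩, hi⟩ := Option.ne_none_iff_exists'.1 hx
  obtain ⟨⟨j, c⟩, hj⟩ := Option.ne_none_iff_exists'.1 hy
  have hbc : b ≠ c := snd_ne_of_link hxy hi hj (fun h => hne (by rw [hi, hj, h]))
  cases b
  · exact not_link_of_lab_d hD hi (h1.trans hi) hxy hne.symm hzw.symm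
      (by rw [h1, h2]; exact hne.symm) hwx.symm
  · cases c
    · exact not_link_of_lab_d hD hj (h2.trans hj) hxy.symm hne hzw
        (by rw [h1, h2]; exact hne) hyz
    · exact hbc rfl

include hD hB in
theorem graph_shortCycleFree : X.graph.ShortCycleFree := by
  refine ⟨graph_loop hD hB, graph_parallel hD hB, ?_, ?_⟩
  · intro x y z hxy hyz hzx
    -- Some edge changes parts, and the cycle is rotated to start there, or the whole cycle lies in
    -- one part.
    by_cases h1 : lab x = lab y
    swap
    · exact triangle_cross hD hB h1 hxy hyz hzx
    by_cases h2 : lab y = lab z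
    swap
    · exact triangle_cross hD hB h2 hyz hzx hxy
    cases hx : lab x with
    | none =>
      obtain ⟨z, rfl⟩ := lab_eq_none.1 (h2 ▸ h1 ▸ hx)
      obtain ⟨y, rfl⟩ := lab_eq_none.1 (h1 ▸ hx)
      obtain ⟨x, rfl⟩ := lab_eq_none.1 hx
      have hl : ∀ {x y : {w : X.W // w ∉ Set.range X.v}}, X.graph.Link (tVert x) (tVert y) →
          X.tree.Link x y := by
        rintro x y ⟨e, he⟩
        obtain ⟨e', -, h⟩ := edge_of_lab_eq_none_of_lab_eq_none he
        exact ⟨e', h⟩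
      exact tree_shortCycleFree.triangle _ _ _ (hl hxy) (hl hyz) (hl hzx)
    | some ib =>
      obtain ⟨i, b⟩ := ib
      cases b
      · obtain ⟨z, rfl⟩ := lab_eq_d.1 (h2 ▸ h1 ▸ hx)
        obtain ⟨y, rfl⟩ := lab_eq_d.1 (h1 ▸ hx)
        obtain ⟨x, rfl⟩ := lab_eq_d.1 hx
        exact (hD i).triangle _ _ _ ((dEmb i).link_of_link hxy) ((dEmb i).link_of_link hyz)
          ((dEmb i).link_of_link hzx)
      · obtain ⟨z, rfl⟩ := lab_eq_b.1 (h2 ▸ h1 ▸ hx)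
        obtain ⟨y, rfl⟩ := lab_eq_b.1 (h1 ▸ hx)
        obtain ⟨x, rfl⟩ := lab_eq_b.1 hx
        exact (hB i).triangle _ _ _ ((bEmb i).link_of_link hxy) ((bEmb i).link_of_link hyz)
          ((bEmb i).link_of_link hzx)
  · intro x y z w hxz hyw hxy hyz hzw hwx
    by_cases h1 : lab x = lab y
    swap
    · exact quad_cross hD hB h1 hxz hyw hxy hyz hzw hwx
    by_cases h2 : lab y = lab z
    swap
    · exact quad_cross hD hB h2 hyw hxz.symm hyz hzw hwx hxy
    by_cases h3 : lab z = lab w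
    swap
    · exact quad_cross hD hB h3 hxz.symm hyw.symm hzw hwx hxy hyz
    cases hx : lab x with
    | none =>
      obtain ⟨w, rfl⟩ := lab_eq_none.1 (h3 ▸ h2 ▸ h1 ▸ hx)
      obtain ⟨z, rfl⟩ := lab_eq_none.1 (h2 ▸ h1 ▸ hx)
      obtain ⟨y, rfl⟩ := lab_eq_none.1 (h1 ▸ hx)
      obtain ⟨x, rfl⟩ := lab_eq_none.1 hx
      have hl : ∀ {x y : {w : X.W // w ∉ Set.range X.v}}, X.graph.Link (tVert x) (tVert y) →
          X.tree.Link x y := by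
        rintro x y ⟨e, he⟩
        obtain ⟨e', -, h⟩ := edge_of_lab_eq_none_of_lab_eq_none he
        exact ⟨e', h⟩
      exact tree_shortCycleFree.quad _ _ _ _ (by rintro rfl; exact hxz rfl)
        (by rintro rfl; exact hyw rfl) (hl hxy) (hl hyz) (hl hzw) (hl hwx)
    | some ib =>
      obtain ⟨i, b⟩ := ib
      cases b
      · obtain ⟨w, rfl⟩ := lab_eq_d.1 (h3 ▸ h2 ▸ h1 ▸ hx)
        obtain ⟨z, rfl⟩ := lab_eq_d.1 (h2 ▸ h1 ▸ hx)
        obtain ⟨y, rfl⟩ := lab_eq_d.1 (h1 ▸ hx)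
        obtain ⟨x, rfl⟩ := lab_eq_d.1 hx
        exact (hD i).quad _ _ _ _ (fun h => hxz (congrArg _ (Subtype.ext h)))
          (fun h => hyw (congrArg _ (Subtype.ext h))) ((dEmb i).link_of_link hxy)
          ((dEmb i).link_of_link hyz) ((dEmb i).link_of_link hzw) ((dEmb i).link_of_link hwx)
      · obtain ⟨w, rfl⟩ := lab_eq_b.1 (h3 ▸ h2 ▸ h1 ▸ hx)
        obtain ⟨z, rfl⟩ := lab_eq_b.1 (h2 ▸ h1 ▸ hx)
        obtain ⟨y, rfl⟩ := lab_eq_b.1 (h1 ▸ hx)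
        obtain ⟨x, rfl⟩ := lab_eq_b.1 hx
        exact (hB i).quad _ _ _ _ (fun h => hxz (congrArg _ (Subtype.ext h)))
          (fun h => hyw (congrArg _ (Subtype.ext h))) ((bEmb i).link_of_link hxy)
          ((bEmb i).link_of_link hyz) ((bEmb i).link_of_link hzw) ((bEmb i).link_of_link hwx)

end Girth

end HalinSnark

/-! ### Cuts around subsets of one pole, and walking around a circle. -/

namespace Multigraph

theorem encard_range_le {α β : Type*} (f : α → β) : (Set.range f).encard ≤ ENat.card α := by
  rw [← Set.image_univ, ← Set.encard_univ]
  exact Set.encard_image_le _ _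

namespace OpenEmbedding

variable {V E V' E' S : Type*} {G : Multigraph V E} {P : Set V} {M : Multigraph V' E'}
  (ι : OpenEmbedding G P M S)

theorem four_le_encard_edgeCut_of_subset_range [Finite V] (hc : G.IsCubic) (hg : G.GirthAtLeast 5)
    (h4 : G.CyclicallyEdgeConnected 4) (hPn : P.Nontrivial) {Q : Set V'}
    (hQ : Q ⊆ Set.range ι.ν) (hnt : Q.Nontrivial) : 4 ≤ (M.edgeCut Q).encard := by
  obtain ⟨Y, rfl⟩ := Set.subset_range_iff_exists_image_eq.1 hQ
  refine le_trans ?_ (ι.encard_edgeCut_le Y)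
  have hY : Y.Nontrivial := by
    obtain ⟨_, ⟨a, ha, rfl⟩, _, ⟨b, hb, rfl⟩, hne⟩ := hnt
    exact ⟨a, ha, b, hb, fun h => hne (congrArg _ h)⟩
  -- The other side of the cut in `G` contains `P`, which has at least two vertices.
  refine four_le_encard_edgeCut hc hg h4 (hY.image Subtype.val_injective) (hPn.mono ?_)
  rintro p hp ⟨x, -, rfl⟩
  exact x.2 hp

theorem three_le_encard_edgeCut_of_subset_range [Finite V] (hc : G.IsCubic) (hg : G.GirthAtLeast 5)
    (h4 : G.CyclicallyEdgeConnected 4) (hPn : P.Nontrivial) {Q : Set V'}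
    (hQ : Q ⊆ Set.range ι.ν) (hne : Q.Nonempty) : 3 ≤ (M.edgeCut Q).encard := by
  rcases Q.subsingleton_or_nontrivial with hs | hnt
  · obtain ⟨q, hq⟩ := hne
    obtain ⟨x, rfl⟩ := hQ hq
    obtain rfl := hs.eq_singleton_of_mem hq
    have := ι.encard_edgeCut_le {x}
    rw [Set.image_singleton, Set.image_singleton] at this
    exact (three_le_encard_edgeCut_singleton hc hg x.1).trans this
  · exact le_trans (by norm_num)
      (ι.four_le_encard_edgeCut_of_subset_range hc hg h4 hPn hQ hnt)

end OpenEmbedding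

end Multigraph

/-- A property that is preserved by all steps but one around a circle is constant. -/
theorem ZMod.iff_of_forall_ne {n : ℕ} [NeZero n] {κ : ZMod n → Prop} (i₀ : ZMod n)
    (h : ∀ i, i ≠ i₀ → (κ i ↔ κ (i + 1))) (i j : ZMod n) : κ i ↔ κ j := by
  have key : ∀ m : ℕ, m < n → (κ (i₀ + 1 + m) ↔ κ (i₀ + 1)) := by
    intro m
    induction m with
    | zero => simp
    | succ m ih =>
      intro hm
      rw [← ih (by omega), h (i₀ + 1 + m)]
      · push_cast
        rw [add_assoc (i₀ + 1)]
      · intro heq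
        -- Starting just after `i₀`, the walk is back at `i₀` only when $n$ divides $m+1$, which is
        -- less than $n$.
        have h0 : ((m + 1 : ℕ) : ZMod n) = 0 := by
          push_cast
          linear_combination heq
        rw [ZMod.natCast_eq_zero_iff] at h0
        exact absurd (Nat.le_of_dvd (by omega) h0) (by omega)
  have all : ∀ i, κ i ↔ κ (i₀ + 1) := by
    intro i
    have := key (i - (i₀ + 1)).val (ZMod.val_lt _)
    rwa [ZMod.natCast_zmod_val, add_sub_cancel] at this
  rw [all i, all j]

/-! ### Zones of the circle of poles. -/

namespace HalinSnark

open Multigraph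

variable {X : HalinSnark.{u}}

theorem card_dIn (i : ZMod X.k) : ENat.card ((X.G i).Freed (X.P i) (X.a i)) = 2 := by
  exact_mod_cast (X.isDecollineator i).1.1

theorem card_dOut (i : ZMod X.k) : ENat.card ((X.G i).Freed (X.P i) (X.b i)) = 2 := by
  exact_mod_cast (X.isDecollineator i).1.2.1

theorem card_bIn (i : ZMod X.k) : ENat.card ((X.G' i).Freed (X.P' i) (X.a' i)) = 2 := by
  exact_mod_cast (X.isPole_B i).1

theorem card_bOut (i : ZMod X.k) : ENat.card ((X.G' i).Freed (X.P' i) (X.b' i)) = 2 := by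
  exact_mod_cast (X.isPole_B i).2.1

theorem card_bRes (i : ZMod X.k) : ENat.card ((X.G' i).Freed (X.P' i) (X.c' i)) = 1 := by
  exact_mod_cast (X.isPole_B i).2.2

theorem encard_edgeCut_P_le (i : ZMod X.k) : ((X.G i).edgeCut (X.P i)).encard ≤ 5 := by
  calc ((X.G i).edgeCut (X.P i)).encard
      ≤ (Set.range (fun s : (X.G i).Freed (X.P i) (X.a i) => s.1.1) ∪
          Set.range (fun s : (X.G i).Freed (X.P i) (X.b i) => s.1.1)).encard := by
        refine Set.encard_le_encard ?_
        rintro e ⟨p, rfl | rfl, x, hx, h⟩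
        · exact Or.inl ⟨⟨(e, x), h, hx⟩, rfl⟩
        · exact Or.inr ⟨⟨(e, x), h, hx⟩, rfl⟩
    _ ≤ 2 + 2 := by
        refine (Set.encard_union_le _ _).trans (add_le_add ?_ ?_)
        · exact (encard_range_le _).trans (card_dIn i).le
        · exact (encard_range_le _).trans (card_dOut i).le
    -- There are only four semiedges; 5 is the bound that `two_le_encard_inner` asks for.
    _ ≤ 5 := by norm_num

theorem encard_edgeCut_P'_le (i : ZMod X.k) : ((X.G' i).edgeCut (X.P' i)).encard ≤ 5 := by
  calc ((X.G' i).edgeCut (X.P' i)).encard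
      ≤ (Set.range (fun s : (X.G' i).Freed (X.P' i) (X.a' i) => s.1.1) ∪
          (Set.range (fun s : (X.G' i).Freed (X.P' i) (X.c' i) => s.1.1) ∪
          Set.range (fun s : (X.G' i).Freed (X.P' i) (X.b' i) => s.1.1))).encard := by
        refine Set.encard_le_encard ?_
        rintro e ⟨p, rfl | rfl | rfl, x, hx, h⟩
        · exact Or.inl ⟨⟨(e, x), h, hx⟩, rfl⟩
        · exact Or.inr (Or.inl ⟨⟨(e, x), h, hx⟩, rfl⟩)
        · exact Or.inr (Or.inr ⟨⟨(e, x), h, hx⟩, rfl⟩)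
    _ ≤ 2 + (1 + 2) := by
        refine (Set.encard_union_le _ _).trans (add_le_add ?_
          ((Set.encard_union_le _ _).trans (add_le_add ?_ ?_)))
        · exact (encard_range_le _).trans (card_bIn i).le
        · exact (encard_range_le _).trans (card_bRes i).le
        · exact (encard_range_le _).trans (card_bOut i).le
    _ ≤ 5 := by norm_num

theorem nontrivial_P (i : ZMod X.k) : (X.P i).Nontrivial :=
  ⟨X.a i, by simp, X.b i, by simp, (X.adj_ab i).1⟩

theorem nontrivial_P' (i : ZMod X.k) : (X.P' i).Nontrivial :=
  ⟨X.a' i, by simp, X.b' i, by simp, X.ne_ab' i⟩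

variable (X) in
/-- The edges inside of a decollineator or a bipartite pole (`inl`), or welded between two of them
(`inr`). -/
def zone : (ZMod X.k × Bool) ⊕ (ZMod X.k × Bool) → Set X.Edg
  | Sum.inl p => {e | ∀ v ∈ X.graph.ends e, lab v = some p}
  | Sum.inr (i, false) => fEdge '' {s | s.1 = i}
  | Sum.inr (i, true) => gEdge '' {s | s.1 = i}

theorem fEdge_notMem_zone_inl (s : X.DOut) (p) : fEdge s ∉ X.zone (Sum.inl p) := by
  intro h
  have h1 := h (dOutVert s) (by rw [ends_fEdge]; exact Sym2.mem_mk_left _ _)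
  have h2 := h (bInVert (X.fEquiv s)) (by rw [ends_fEdge]; exact Sym2.mem_mk_right _ _)
  rw [← h2] at h1
  simp at h1

theorem gEdge_notMem_zone_inl (s : X.BOut) (p) : gEdge s ∉ X.zone (Sum.inl p) := by
  intro h
  have h1 := h (bOutVert s) (by rw [ends_gEdge]; exact Sym2.mem_mk_left _ _)
  have h2 := h (dInVert (X.gEquiv s)) (by rw [ends_gEdge]; exact Sym2.mem_mk_right _ _)
  rw [← h2] at h1
  simp at h1

theorem zone_unique {e : X.Edg} {z z'} (h : e ∈ X.zone z) (h' : e ∈ X.zone z') : z = z' := by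
  rcases z with p | ⟨i, _ | _⟩
  · rcases z' with q | ⟨j, _ | _⟩
    · obtain ⟨v, hv⟩ : ∃ v, v ∈ X.graph.ends e := by
        induction hs : X.graph.ends e using Sym2.ind with | _ x y => exact ⟨x, Sym2.mem_mk_left _ _⟩
      rw [Option.some.inj ((h v hv).symm.trans (h' v hv))]
    · obtain ⟨s, -, rfl⟩ := h'
      exact absurd h (fEdge_notMem_zone_inl s p)
    · obtain ⟨s, -, rfl⟩ := h'
      exact absurd h (gEdge_notMem_zone_inl s p)
  · obtain ⟨s, hs, rfl⟩ := h
    rcases z' with q | ⟨j, _ | _⟩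
    · exact absurd h' (fEdge_notMem_zone_inl s q)
    · obtain ⟨t, ht, h⟩ := h'
      rw [fEdge_injective h] at ht
      rw [← hs, ← ht]
    · obtain ⟨t, ht, h⟩ := h'
      simp [fEdge, gEdge] at h
  · obtain ⟨s, hs, rfl⟩ := h
    rcases z' with q | ⟨j, _ | _⟩
    · exact absurd h' (gEdge_notMem_zone_inl s q)
    · obtain ⟨t, ht, h⟩ := h'
      simp [fEdge, gEdge] at h
    · obtain ⟨t, ht, h⟩ := h'
      rw [gEdge_injective h] at ht
      rw [← hs, ← ht]

/-- All vertices of a decollineator or bipartite pole belong to `Y`. -/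
def AllIn (Y : Set X.Vert) (p : ZMod X.k × Bool) : Prop := ∀ v, lab v = some p → v ∈ Y

/-- At least two edges of the zone belong to the edge-cut around `Y`. -/
def Busy (Y : Set X.Vert) (z : (ZMod X.k × Bool) ⊕ (ZMod X.k × Bool)) : Prop :=
  2 ≤ (X.graph.edgeCut Y ∩ X.zone z).encard

/-- Zones are disjoint, so two busy ones would contribute four edges. -/
theorem eq_of_busy {Y : Set X.Vert} (hY : (X.graph.edgeCut Y).encard < 4) {z z'}
    (h : Busy Y z) (h' : Busy Y z') : z = z' := by
  by_contra hne
  refine absurd hY (not_lt.2 ?_)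
  calc (4 : ℕ∞) = 2 + 2 := by norm_num
    _ ≤ (X.graph.edgeCut Y ∩ X.zone z).encard + (X.graph.edgeCut Y ∩ X.zone z').encard :=
        add_le_add h h'
    _ = ((X.graph.edgeCut Y ∩ X.zone z) ∪ (X.graph.edgeCut Y ∩ X.zone z')).encard := by
        rw [Set.encard_union_eq]
        rw [Set.disjoint_left]
        exact fun e he he' => hne (zone_unique he.2 he'.2)
    _ ≤ _ := Set.encard_le_encard (Set.union_subset Set.inter_subset_left Set.inter_subset_left)

theorem busy_f {Y : Set X.Vert} {i : ZMod X.k}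
    (h : ∀ s : X.DOut, s.1 = i → fEdge s ∈ X.graph.edgeCut Y) : Busy Y (Sum.inr (i, false)) := by
  rw [Busy, zone, Set.inter_eq_right.2 (by rintro _ ⟨s, hs, rfl⟩; exact h s hs),
    fEdge_injective.encard_image,
    show {s : X.DOut | s.1 = i} = Set.range (Sigma.mk i) by ext ⟨j, s⟩; simp,
    ← Set.image_univ, sigma_mk_injective.encard_image, Set.encard_univ, card_dOut]

theorem busy_g {Y : Set X.Vert} {i : ZMod X.k}
    (h : ∀ s : X.BOut, s.1 = i → gEdge s ∈ X.graph.edgeCut Y) : Busy Y (Sum.inr (i, true)) := by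
  rw [Busy, zone, Set.inter_eq_right.2 (by rintro _ ⟨s, hs, rfl⟩; exact h s hs),
    gEdge_injective.encard_image,
    show {s : X.BOut | s.1 = i} = Set.range (Sigma.mk i) by ext ⟨j, s⟩; simp,
    ← Set.image_univ, sigma_mk_injective.encard_image, Set.encard_univ, card_bOut]

/-- Poles on different sides would put both edges welded between them into the cut. -/
theorem allIn_f_iff {Y : Set X.Vert} {i : ZMod X.k} (h : ¬ Busy Y (Sum.inr (i, false)))
    (hd : AllIn Y (i, false) ∨ AllIn Yᶜ (i, false)) (hb : AllIn Y (i, true) ∨ AllIn Yᶜ (i, true)) :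
    AllIn Y (i, false) ↔ AllIn Y (i, true) := by
  rcases hd with hd | hd <;> rcases hb with hb | hb
  · simp [hd, hb]
  · refine absurd (busy_f ?_) h
    rintro s rfl
    exact ⟨dOutVert s, hd _ rfl, bInVert (X.fEquiv s), hb _ rfl, rfl⟩
  · refine absurd (busy_f ?_) h
    rintro s rfl
    exact ⟨bInVert (X.fEquiv s), hb _ rfl, dOutVert s, hd _ rfl, Sym2.eq_swap⟩
  -- A semiedge provides a vertex in each pole, so that `AllIn Y` is not vacuously true.
  · obtain ⟨s⟩ : Nonempty ((X.G i).Freed (X.P i) (X.b i)) := by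
      by_contra hne
      rw [not_nonempty_iff] at hne
      exact absurd ((card_dOut i).symm.trans ((ENat.card_eq_zero_iff_empty _).2 hne)) (by norm_num)
    constructor
    · intro h'
      exact absurd (h' (dOutVert ⟨i, s⟩) rfl) (hd _ rfl)
    · intro h'
      exact absurd (h' (bInVert (X.fEquiv ⟨i, s⟩)) rfl) (hb _ rfl)

theorem allIn_g_iff {Y : Set X.Vert} {i : ZMod X.k} (h : ¬ Busy Y (Sum.inr (i, true)))
    (hb : AllIn Y (i, true) ∨ AllIn Yᶜ (i, true))
    (hd : AllIn Y (i + 1, false) ∨ AllIn Yᶜ (i + 1, false)) :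
    AllIn Y (i, true) ↔ AllIn Y (i + 1, false) := by
  rcases hd with hd | hd <;> rcases hb with hb | hb
  · simp [hd, hb]
  · refine absurd (busy_g ?_) h
    rintro s rfl
    exact ⟨dInVert (X.gEquiv s), hd _ rfl, bOutVert s, hb _ rfl, Sym2.eq_swap⟩
  · refine absurd (busy_g ?_) h
    rintro s rfl
    exact ⟨bOutVert s, hb _ rfl, dInVert (X.gEquiv s), hd _ rfl, rfl⟩
  · obtain ⟨s⟩ : Nonempty ((X.G' i).Freed (X.P' i) (X.b' i)) := by
      by_contra hne
      rw [not_nonempty_iff] at hne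
      exact absurd ((card_bOut i).symm.trans ((ENat.card_eq_zero_iff_empty _).2 hne)) (by norm_num)
    constructor
    · intro h'
      exact absurd (h' (bOutVert ⟨i, s⟩) rfl) (hb _ rfl)
    · intro h'
      exact absurd (h' (dInVert (X.gEquiv ⟨i, s⟩)) rfl) (hd _ rfl)

/-! ### Small cuts do not separate cycles. -/

section Connectivity

variable (hD : ∀ i, (X.G i).CyclicallyEdgeConnected 4 ∧ (X.G i).GirthAtLeast 5)
    (hB : ∀ i, (X.G' i).CyclicallyEdgeConnected 4 ∧ (X.G' i).GirthAtLeast 5)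

include hD hB in
theorem allIn_or_allIn_compl {Y : Set X.Vert} {p : ZMod X.k × Bool} (h : ¬ Busy Y (Sum.inl p)) :
    AllIn Y p ∨ AllIn Yᶜ p := by
  by_contra! hcon
  obtain ⟨h1, h2⟩ := hcon
  simp only [AllIn, not_forall] at h1 h2
  obtain ⟨b, hb, hbY⟩ := h1
  obtain ⟨a, ha, haY⟩ := h2
  rw [Set.notMem_compl_iff] at haY
  apply h
  obtain ⟨i, _ | _⟩ := p
  · have := X.finite_V i
    obtain ⟨a, rfl⟩ := lab_eq_d.1 ha
    obtain ⟨b, rfl⟩ := lab_eq_d.1 hb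
    have := (dEmb i).two_le_encard_inner (X.cubic_G i) (hD i).2 (hD i).1 (nontrivial_P i)
      (encard_edgeCut_P_le i) ((hD i).2.shortCycleFree.eq_of_link_edge (link_ab i)) haY hbY
    refine this.trans (Set.encard_le_encard ?_)
    rintro e ⟨h1, h2⟩
    exact ⟨h1, fun v hv => lab_eq_d.2 (h2 v hv)⟩
  · have := X.finite_V' i
    obtain ⟨a, rfl⟩ := lab_eq_b.1 ha
    obtain ⟨b, rfl⟩ := lab_eq_b.1 hb
    have := (bEmb i).two_le_encard_inner (X.cubic_G' i) (hB i).2 (hB i).1 (nontrivial_P' i)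
      (encard_edgeCut_P'_le i) ((hB i).2.shortCycleFree.eq_of_link_path (link_ac' i) (link_cb' i)
        (X.ne_ab' i)) haY hbY
    refine this.trans (Set.encard_le_encard ?_)
    rintro e ⟨h1, h2⟩
    exact ⟨h1, fun v hv => lab_eq_b.2 (h2 v hv)⟩

include hD hB in
/-- For a small edge-cut, all decollineators and bipartite poles but one are on the same side. -/
theorem exists_forall_allIn {Y : Set X.Vert} (hY : (X.graph.edgeCut Y).encard < 4) :
    ∃ p₀, (∀ p, p ≠ p₀ → AllIn Y p) ∨ ∀ p, p ≠ p₀ → AllIn Yᶜ p := by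
  have : NeZero X.k := ⟨by have := X.isHalin.three_le; omega⟩
  -- The weld that follows a pole is grouped with it: when either is busy, leaving out this pole
  -- breaks the circle into a path without busy zones.
  have hcases : (∃ i₀, ∀ z, Busy Y z → z = Sum.inl (i₀, false) ∨ z = Sum.inr (i₀, false)) ∨
      ∃ i₀, ∀ z, Busy Y z → z = Sum.inl (i₀, true) ∨ z = Sum.inr (i₀, true) := by
    by_cases h : ∃ z, Busy Y z
    · obtain ⟨z, hz⟩ := h
      rcases z with ⟨i, _ | _⟩ | ⟨i, _ | _⟩
      · exact Or.inl ⟨i, fun z' hz' => Or.inl (eq_of_busy hY hz' hz)⟩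
      · exact Or.inr ⟨i, fun z' hz' => Or.inl (eq_of_busy hY hz' hz)⟩
      · exact Or.inl ⟨i, fun z' hz' => Or.inr (eq_of_busy hY hz' hz)⟩
      · exact Or.inr ⟨i, fun z' hz' => Or.inr (eq_of_busy hY hz' hz)⟩
    · exact Or.inl ⟨0, fun z hz => absurd ⟨z, hz⟩ h⟩
  rcases hcases with ⟨i₀, h⟩ | ⟨i₀, h⟩
  · have hsplit : ∀ p, p ≠ (i₀, false) → AllIn Y p ∨ AllIn Yᶜ p := fun p hp =>
      allIn_or_allIn_compl hD hB fun hb => by simpa [hp] using h _ hb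
    have hf : ∀ i, i ≠ i₀ → (AllIn Y (i, false) ↔ AllIn Y (i, true)) := fun i hi =>
      allIn_f_iff (fun hb => by simpa [hi] using h _ hb) (hsplit _ (by simpa using hi))
        (hsplit _ (by simp))
    have hg : ∀ i, i + 1 ≠ i₀ → (AllIn Y (i, true) ↔ AllIn Y (i + 1, false)) := fun i hi =>
      allIn_g_iff (fun hb => by simpa using h _ hb) (hsplit _ (by simp))
        (hsplit _ (by simpa using hi))
    -- The step from $B_i$ to $B_{i+1}$ passes through $D_{i+1}$, so the exceptional one is at `i₀ -
    -- 1`.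
    have hall := ZMod.iff_of_forall_ne (κ := fun i => AllIn Y (i, true)) (i₀ - 1) fun i hi => by
      have hi' : i + 1 ≠ i₀ := fun h => hi (by rw [← h, add_sub_cancel_right])
      rw [hg i hi', hf _ hi']
    refine ⟨(i₀, false), ?_⟩
    by_cases h0 : AllIn Y (i₀, true)
    · left
      rintro ⟨i, _ | _⟩ hp
      · exact (hf i (by simpa using hp)).2 ((hall i i₀).2 h0)
      · exact (hall i i₀).2 h0
    · right
      rintro ⟨i, _ | _⟩ hp
      · refine (hsplit _ hp).resolve_left fun h1 => h0 ?_
        exact (hall i i₀).1 ((hf i (by simpa using hp)).1 h1)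
      · exact (hsplit _ hp).resolve_left fun h1 => h0 ((hall i i₀).1 h1)
  · have hsplit : ∀ p, p ≠ (i₀, true) → AllIn Y p ∨ AllIn Yᶜ p := fun p hp =>
      allIn_or_allIn_compl hD hB fun hb => by simpa [hp] using h _ hb
    have hf : ∀ i, i ≠ i₀ → (AllIn Y (i, false) ↔ AllIn Y (i, true)) := fun i hi =>
      allIn_f_iff (fun hb => by simpa using h _ hb) (hsplit _ (by simp))
        (hsplit _ (by simpa using hi))
    have hg : ∀ i, i ≠ i₀ → (AllIn Y (i, true) ↔ AllIn Y (i + 1, false)) := fun i hi =>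
      allIn_g_iff (fun hb => by simpa [hi] using h _ hb) (hsplit _ (by simpa using hi))
        (hsplit _ (by simp))
    have hall := ZMod.iff_of_forall_ne (κ := fun i => AllIn Y (i, false)) i₀ fun i hi => by
      rw [hf i hi, hg i hi]
    refine ⟨(i₀, true), ?_⟩
    by_cases h0 : AllIn Y (i₀, false)
    · left
      rintro ⟨i, _ | _⟩ hp
      · exact (hall i i₀).2 h0
      · exact (hf i (by simpa using hp)).1 ((hall i i₀).2 h0)
    · right
      rintro ⟨i, _ | _⟩ hp
      · exact (hsplit _ hp).resolve_left fun h1 => h0 ((hall i i₀).1 h1)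
      · refine (hsplit _ hp).resolve_left fun h1 => h0 ?_
        exact (hall i i₀).1 ((hf i (by simpa using hp)).2 h1)

/-- The vertex of the Halin graph from which a vertex of the Halin snark arises. -/
def proj : X.Vert → X.W := Sum.elim (fun x => X.v x.1) Subtype.val

theorem eq_t_of_adj {i : ZMod X.k} {w : {w : X.W // w ∉ Set.range X.v}} (h : X.S.Adj w (X.v i)) :
    w = X.t i := by
  have h1 := (X.isHalin.leaves (X.v i)).1 ⟨i, rfl⟩
  exact Subtype.ext (Set.encard_le_one_iff_subsingleton.1 h1.le h.symm (X.adj_t i))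

/-- The three neighbours of `w` in the cubic Halin graph give different edges: tree edges to inner
vertices, residual edges in place of edges to leaves. `proj` recovers the neighbour from the edge.
-/
theorem three_le_degree_tVert (w : {w : X.W // w ∉ Set.range X.v}) :
    3 ≤ {e | tVert w ∈ X.graph.ends e}.encard := by
  rw [← X.isHalin.cubic w]
  have hex : ∀ n : (X.S ⊔ circuitGraph X.v).neighborSet w,
      ∃ e q, X.graph.ends e = s(tVert w, q) ∧ proj q = n.1 := by
    rintro ⟨n, hn⟩
    have hS : X.S.Adj w n := by
      rcases hn with hn | hn
      · exact hn
      -- Edges of the circuit join leaves, and `w` is not a leaf.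
      · exfalso
        rw [circuitGraph, SimpleGraph.fromEdgeSet_adj] at hn
        obtain ⟨⟨i, hi⟩, -⟩ := hn
        have : w.1 ∈ s(X.v i, X.v (i + 1)) := by
          rw [show s(X.v i, X.v (i + 1)) = s(w.1, n) from hi]
          exact Sym2.mem_mk_left _ _
        rw [Sym2.mem_iff] at this
        rcases this with h | h <;> exact w.2 ⟨_, h.symm⟩
    by_cases hnv : n ∈ Set.range X.v
    · obtain ⟨i, rfl⟩ := hnv
      obtain ⟨s⟩ : Nonempty ((X.G' i).Freed (X.P' i) (X.c' i)) := by
        by_contra hne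
        rw [not_nonempty_iff] at hne
        exact absurd ((card_bRes i).symm.trans ((ENat.card_eq_zero_iff_empty _).2 hne)) (by norm_num)
      refine ⟨rEdge ⟨i, s⟩, bResVert ⟨i, s⟩, ?_, rfl⟩
      rw [ends_rEdge, eq_t_of_adj hS, Sym2.eq_swap]
    · exact ⟨tEdge ⟨s(w, ⟨n, hnv⟩), hS⟩, tVert ⟨n, hnv⟩, rfl, rfl⟩
  choose e q heq hq using hex
  have hinj : Function.Injective e := by
    intro n n' h
    have h1 := heq n
    rw [h, heq n', Sym2.congr_right] at h1
    exact Subtype.ext (by rw [← hq, ← hq, h1])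
  calc _ = Set.univ.encard := (Set.encard_univ _).symm
    _ = (e '' Set.univ).encard := (hinj.encard_image _).symm
    _ ≤ _ := by
        refine Set.encard_le_encard ?_
        rintro _ ⟨n, -, rfl⟩
        exact Set.mem_ofPred.2 (by rw [heq]; exact Sym2.mem_mk_left _ _)

theorem finite_vert : Finite X.Vert := by
  have : NeZero X.k := ⟨by have := X.isHalin.three_le; omega⟩
  have := X.finite_W
  have := X.finite_V
  have := X.finite_V'
  infer_instance

theorem three_le_encard_edgeCut_of_lab_eq_none {Z : Set X.Vert} (hZ : ∀ v ∈ Z, lab v = none)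
    (hne : Z.Nonempty) : 3 ≤ (X.graph.edgeCut Z).encard := by
  have := finite_vert (X := X)
  have h := encard_add_two_le_encard_edgeCut Z.toFinite hne (fun v hv => by
    obtain ⟨w, rfl⟩ := lab_eq_none.1 (hZ v hv)
    exact three_le_degree_tVert w) (not_hasCycleIn_of_lab_eq_none hZ)
  refine le_trans ?_ h
  calc (3 : ℕ∞) = 1 + 2 := by norm_num
    _ ≤ _ := by
      gcongr
      exact Set.one_le_encard_iff_nonempty.2 hne

include hD hB in
-- At most one edge joins $Q$ and $Z$, the residual one. If both are nonempty, each sends out at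
-- least three edges, hence at least two others, and these all leave $Y$. If $Z$ is empty, $Q$
-- contains a cycle and alone sends out four.
theorem four_le_encard_edgeCut_of_forall_allIn {Y : Set X.Vert} {p₀}
    (h : ∀ p, p ≠ p₀ → AllIn Yᶜ p) (hcyc : ∃ n, X.graph.HasCycleIn Y n) :
    4 ≤ (X.graph.edgeCut Y).encard := by
  set Q := {v ∈ Y | lab v = some p₀} with hQ
  set Z := {v ∈ Y | lab v = none} with hZ
  have hYQZ : Y = Q ∪ Z := by
    ext v
    constructor
    · intro hv
      cases hl : lab v with
      | none => exact Or.inr ⟨hv, hl⟩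
      | some p =>
        by_cases hp : p = p₀
        · exact Or.inl ⟨hv, hp ▸ hl⟩
        · exact absurd hv (h p hp v hl)
    · rintro (hv | hv) <;> exact hv.1
  obtain ⟨n, hcyc⟩ := hcyc
  have hgirth := (graph_shortCycleFree (fun i => (hD i).2.shortCycleFree)
    fun i => (hB i).2.shortCycleFree).girthAtLeast
  have hQcut : (Q.Nontrivial → 4 ≤ (X.graph.edgeCut Q).encard) ∧
      (Q.Nonempty → 3 ≤ (X.graph.edgeCut Q).encard) := by
    obtain ⟨i, _ | _⟩ := p₀
    · have := X.finite_V i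
      have hsub : Q ⊆ Set.range (dEmb i).ν := fun v hv => lab_eq_d.1 hv.2
      exact ⟨(dEmb i).four_le_encard_edgeCut_of_subset_range (X.cubic_G i) (hD i).2 (hD i).1
        (nontrivial_P i) hsub, (dEmb i).three_le_encard_edgeCut_of_subset_range (X.cubic_G i)
        (hD i).2 (hD i).1 (nontrivial_P i) hsub⟩
    · have := X.finite_V' i
      have hsub : Q ⊆ Set.range (bEmb i).ν := fun v hv => lab_eq_b.1 hv.2
      exact ⟨(bEmb i).four_le_encard_edgeCut_of_subset_range (X.cubic_G' i) (hB i).2 (hB i).1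
        (nontrivial_P' i) hsub, (bEmb i).three_le_encard_edgeCut_of_subset_range (X.cubic_G' i)
        (hB i).2 (hB i).1 (nontrivial_P' i) hsub⟩
  rcases Q.eq_empty_or_nonempty with hQ0 | hQ0
  · rw [hQ0, Set.empty_union] at hYQZ
    exact absurd (hYQZ ▸ hcyc) (not_hasCycleIn_of_lab_eq_none (fun v hv => hv.2) n)
  rcases Z.eq_empty_or_nonempty with hZ0 | hZ0
  · rw [hZ0, Set.union_empty] at hYQZ
    rw [hYQZ]
    apply hQcut.1
    by_contra hnt
    rw [Set.not_nontrivial_iff] at hnt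
    exact hgirth.not_hasCycleIn_of_subsingleton hnt n (hYQZ ▸ hcyc)
  set K : Set X.Edg := rEdge '' {s | s.1 = p₀.1} with hK
  have hK1 : K.encard ≤ 1 := by
    rw [Set.encard_le_one_iff_subsingleton]
    rintro _ ⟨s, hs, rfl⟩ _ ⟨t, ht, rfl⟩
    exact congrArg rEdge (res_unique (hs.trans ht.symm))
  have hKmem : ∀ e q z, q ∈ Q → z ∈ Z → X.graph.ends e = s(q, z) → e ∈ K := by
    intro e q z hq hz he
    obtain ⟨s, rfl, rfl⟩ := edge_of_lab_eq_none he (by rw [hq.2]; simp) hz.2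
    have := hq.2
    rw [lab_bResVert, Option.some.injEq] at this
    exact ⟨s, by rw [← this]; rfl, rfl⟩
  have hdiff : ∀ A : Set X.Edg, 3 ≤ A.encard → 2 ≤ (A \ K).encard := by
    intro A hA
    have h3 : (2 : ℕ∞) + 1 ≤ (A \ K).encard + 1 := by
      calc (2 : ℕ∞) + 1 = 3 := by norm_num
        _ ≤ _ := hA
        _ ≤ (A \ K).encard + K.encard := Set.encard_le_encard_sdiff_add_encard A K
        _ ≤ _ := by gcongr
    exact (ENat.add_le_add_iff_right (by simp)).1 h3
  have hQ2 := hdiff _ (hQcut.2 hQ0)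
  have hZ2 := hdiff _ (three_le_encard_edgeCut_of_lab_eq_none (fun v hv => hv.2) hZ0)
  calc (4 : ℕ∞) = 2 + 2 := by norm_num
    _ ≤ _ := add_le_add hQ2 hZ2
    _ = ((X.graph.edgeCut Q \ K) ∪ (X.graph.edgeCut Z \ K)).encard := by
        rw [Set.encard_union_eq]
        rw [Set.disjoint_left]
        rintro e ⟨⟨q, hq, y, hy, he⟩, heK⟩ ⟨⟨z, hz, y', hy', he'⟩, -⟩
        have hqz : q ≠ z := by
          rintro rfl
          have := hq.2
          rw [hz.2] at this
          simp at this
        rw [he, Sym2.eq_iff] at he'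
        rcases he' with ⟨h1, -⟩ | ⟨-, rfl⟩
        · exact hqz h1
        · exact heK (hKmem e q y hq hz he)
    _ ≤ _ := by
        refine Set.encard_le_encard ?_
        rintro e (⟨⟨q, hq, y, hy, he⟩, heK⟩ | ⟨⟨z, hz, y, hy, he⟩, heK⟩)
        · refine ⟨q, hq.1, y, fun hyY => ?_, he⟩
          rw [hYQZ] at hyY
          exact heK (hKmem e q y hq (hyY.resolve_left hy) he)
        · refine ⟨z, hz.1, y, fun hyY => ?_, he⟩
          rw [hYQZ] at hyY
          exact heK (hKmem e y z (hyY.resolve_right hy) hz (he.trans Sym2.eq_swap))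

end Connectivity

end HalinSnark

theorem proposition8p1 (X : HalinSnark.{u})
    (hD : ∀ i, (X.G i).CyclicallyEdgeConnected 4 ∧ (X.G i).GirthAtLeast 5)
    (hB : ∀ i, (X.G' i).CyclicallyEdgeConnected 4 ∧ (X.G' i).GirthAtLeast 5) :
    X.graph.CyclicallyEdgeConnected 4 ∧ X.graph.GirthAtLeast 5 := by
  refine ⟨fun Y h1 h2 => ?_, (HalinSnark.graph_shortCycleFree (fun i => (hD i).2.shortCycleFree)
    fun i => (hB i).2.shortCycleFree).girthAtLeast⟩
  -- The assumption that the cut is small is what yields the exceptional pole.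
  by_contra! hlt
  refine absurd hlt (not_lt.2 ?_)
  obtain ⟨p₀, h | h⟩ := HalinSnark.exists_forall_allIn hD hB hlt
  -- Here the other poles are in `Y`, so the cycle in the complement is used.
  · rw [← Multigraph.edgeCut_compl]
    exact HalinSnark.four_le_encard_edgeCut_of_forall_allIn hD hB (by rwa [compl_compl]) h2
  · exact HalinSnark.four_le_encard_edgeCut_of_forall_allIn hD hB h h1
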